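/- Let $(M,J,g)$ be an almost Hermitian manifold of real dimension $2n$, i.e. $M$ is a smooth manifold, $J$ a smooth almost complex structure and $g=\langle\cdot,\cdot\rangle$ a smooth Riemannian metric with $g(JX,JY)=g(X,Y)$. Let $D$ be the Levi-Civita connection of $g$ and let $\nabla$ be the canonical connection of $(M,J,g)$, i.e. the unique connection with $\nabla g=0$, $\nabla J=0$ whose torsion $\tau(X,Y)=\nabla_XY-\nabla_YX-[X,Y]$ satisfies $\tau(X,\overline Y)=0$ for all $(1,0)$-vectors $X,Y$. Extend $g$, $D$, $\nabla$, $\tau$ and the Lie bracket complex (bi)linearly to the complexified tangent bundle. Let $(e_1,\dots,e_n)$ be a local unitary $(1,0)$-frame, i.e. $Je_i=\sqrt{-1}\,e_i$ and $\langle e_i,\overline{e_j}\rangle=\delta_{ij}$, and write $$\tau(e_k,e_l)=\sum_\lambda\big(\tau_{kl}^{\lambda}e_\lambda+\tau_{kl}^{\bar\lambda}\overline{e_\lambda}\big),$$ let $\tau_{kl;i}^{\bar j}$ be the $\overline{e_j}$-component of $(\nabla_{e_i}\tau)(e_k,e_l)$, and let $$R^L_{ijkl}=\langle D_{e_k}D_{e_l}e_i-D_{e_l}D_{e_k}e_i-D_{[e_k,e_l]}e_i,\;e_j\rangle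 .$$ Then, for all $i,j,k,l\in\{1,\dots,n\}$, $$\begin{aligned} R^L_{ijkl}=&\tfrac12\big(\tau_{kl;i}^{\bar j}-\tau_{kl;j}^{\bar i}\big)+\tfrac12\big(\tau_{ij;k}^{\bar l}-\tau_{ij;l}^{\bar k}\big)+\tfrac12\sum_\lambda\big(\tau_{ij}^\lambda\tau_{kl}^{\bar\lambda}+\tau_{ij}^{\bar\lambda}\tau_{kl}^\lambda\big)\\ &+\tfrac14\sum_\lambda\tau_{ik}^\lambda\big(\tau_{jl}^{\bar\lambda}-\tau_{l\lambda}^{\bar j}-\tau_{\lambda j}^{\bar l}\big)+\tfrac14\sum_\lambda\tau_{jl}^\lambda\big(\tau_{ik}^{\bar\lambda}-\tau_{k\lambda}^{\bar i}-\tau_{\lambda i}^{\bar k}\big)\\ &-\tfrac14\sum_\lambda\tau_{il}^\lambda\big(\tau_{jk}^{\bar\lambda}-\tau_{k\lambda}^{\bar j}-\tau_{\lambda j}^{\bar k}\big)-\tfrac14\sum_\lambda\tau_{jk}^\lambda\big(\tau_{il}^{\bar\lambda}-\tau_{l\lambda}^{\bar i}-\tau_{\lambda i}^{\bar l}\big).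 \end{aligned}$$ In particular, $R^L_{ijkl}=0$ for all $i,j,k,l$ if $(M,J,g)$ is Hermitian (that is, the Nijenhuis tensor $N(X,Y)=[JX,JY]-J[JX,Y]-J[X,JY]-[X,Y]$ of $J$ vanishes), and also if $(M,J,g)$ is nearly Kähler (that is, $(D_XJ)X=0$ for every vector field $X$). -/

import Mathlib

open Bundle
open scoped Manifold ContDiff

/-! ### Complexification of a real vector space -/

/-- The complexification `V ⊕ iV` of a real vector space: `⟨a, b⟩` stands for `a + i b`. -/
@[ext]
structure Cplx (V : Type*) where
  re : V
  im : V

namespace Cplx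

section Module

variable {V : Type*} [AddCommGroup V]

instance : Zero (Cplx V) := ⟨⟨0, 0⟩⟩
instance : Add (Cplx V) := ⟨fun v w => ⟨v.re + w.re, v.im + w.im⟩⟩
instance : Neg (Cplx V) := ⟨fun v => ⟨-v.re, -v.im⟩⟩
instance : Sub (Cplx V) := ⟨fun v w => ⟨v.re - w.re, v.im - w.im⟩⟩

@[simp] lemma zero_re : (0 : Cplx V).re = 0 := rfl
@[simp] lemma zero_im : (0 : Cplx V).im = 0 := rfl
@[simp] lemma add_re (v w : Cplx V) : (v + w).re = v.re + w.re := rfl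
@[simp] lemma add_im (v w : Cplx V) : (v + w).im = v.im + w.im := rfl
@[simp] lemma neg_re (v : Cplx V) : (-v).re = -v.re := rfl
@[simp] lemma neg_im (v : Cplx V) : (-v).im = -v.im := rfl
@[simp] lemma sub_re (v w : Cplx V) : (v - w).re = v.re - w.re := rfl
@[simp] lemma sub_im (v w : Cplx V) : (v - w).im = v.im - w.im := rfl

instance : AddCommGroup (Cplx V) where
  add_assoc u v w := by ext <;> simp [add_assoc]
  zero_add v := by ext <;> simp
  add_zero v := by ext <;> simp
  add_comm v w := by ext <;> simp [add_comm]
  neg_add_cancel v := by ext <;> simp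
  sub_eq_add_neg v w := by ext <;> simp [sub_eq_add_neg]
  nsmul := nsmulRec
  zsmul := zsmulRec

variable [Module ℝ V]

/-- `(s + i t) (a + i b) = (s a - t b) + i (s b + t a)`. -/
instance : SMul ℂ (Cplx V) :=
  ⟨fun c v => ⟨c.re • v.re - c.im • v.im, c.re • v.im + c.im • v.re⟩⟩

@[simp] lemma smul_re (c : ℂ) (v : Cplx V) : (c • v).re = c.re • v.re - c.im • v.im := rfl
@[simp] lemma smul_im (c : ℂ) (v : Cplx V) : (c • v).im = c.re • v.im + c.im • v.re := rfl

instance : Module ℂ (Cplx V) where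
  one_smul v := by ext <;> simp
  mul_smul a b v := by ext <;> simp <;> module
  smul_zero a := by ext <;> simp
  smul_add a v w := by ext <;> simp <;> module
  add_smul a b v := by ext <;> simp <;> module
  zero_smul v := by ext <;> simp

/-- Complex conjugation. -/
def conj (v : Cplx V) : Cplx V := ⟨v.re, -v.im⟩

/-- The complex linear extension of a real linear endomorphism. -/
noncomputable def extendLin [TopologicalSpace V] (A : V →L[ℝ] V) (v : Cplx V) : Cplx V := ⟨A v.re, A v.im⟩

/-- The complex bilinear extension of a real bilinear map with values in the same space. -/
noncomputable def extendBilin [TopologicalSpace V] [IsTopologicalAddGroup V] [ContinuousSMul ℝ V]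
    (B : V →L[ℝ] V →L[ℝ] V) (v w : Cplx V) : Cplx V :=
  ⟨B v.re w.re - B v.im w.im, B v.re w.im + B v.im w.re⟩

/-- The complex *bilinear* extension of a real bilinear form (later: of the metric). -/
noncomputable def pairing [TopologicalSpace V] [IsTopologicalAddGroup V] [ContinuousSMul ℝ V]
    (B : V →L[ℝ] V →L[ℝ] ℝ) (v w : Cplx V) : ℂ :=
  ⟨B v.re w.re - B v.im w.im, B v.re w.im + B v.im w.re⟩

end Module

section Expansion

variable {V : Type*} [AddCommGroup V] [Module ℝ V]

/-- The underlying real vector space of the complexification. -/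
noncomputable def equivProd : Cplx V ≃ₗ[ℝ] V × V where
  toFun v := (v.re, v.im)
  invFun v := ⟨v.1, v.2⟩
  map_add' _ _ := rfl
  map_smul' c v := by
    change (((c : ℂ) • v).re, ((c : ℂ) • v).im) = (c • v.re, c • v.im)
    rw [smul_re, smul_im]
    simp
  left_inv _ := rfl
  right_inv _ := rfl

instance [FiniteDimensional ℝ V] : FiniteDimensional ℂ (Cplx V) :=
  have : Module.Finite ℝ (Cplx V) := Module.Finite.equiv (equivProd (V := V)).symm
  Module.Finite.of_restrictScalars_finite ℝ ℂ (Cplx V)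

lemma finrank_eq [FiniteDimensional ℝ V] : Module.finrank ℂ (Cplx V) = Module.finrank ℝ V := by
  have h1 := finrank_real_of_complex (Cplx V)
  have h2 := (equivProd (V := V)).finrank_eq
  rw [Module.finrank_prod] at h2
  omega

variable [TopologicalSpace V] [IsTopologicalAddGroup V] [ContinuousSMul ℝ V]

/-- The complex linear form `v ↦ pairing B v w`. -/
noncomputable def pairingLin (B : V →L[ℝ] V →L[ℝ] ℝ) (w : Cplx V) : Cplx V →ₗ[ℂ] ℂ where
  toFun v := pairing B v w
  map_add' u v := by
    apply Complex.ext <;> simp [pairing] <;> ring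
  map_smul' c v := by
    apply Complex.ext <;> simp [pairing] <;> ring

/-- In a unitary frame the components of a vector are its pairings with the conjugate frame. -/
theorem eq_sum_pairing [FiniteDimensional ℝ V] (B : V →L[ℝ] V →L[ℝ] ℝ)
    (hB : ∀ v w, B v w = B w v) (A : V →L[ℝ] V) (hA : ∀ v w, B (A v) (A w) = B v w)
    {n : ℕ} (hdim : Module.finrank ℝ V = 2 * n)
    (e : Fin n → Cplx V) (h₁ : ∀ i, extendLin A (e i) = Complex.I • e i)
    (h₂ : ∀ i j, pairing B (e i) (e j).conj = if i = j then 1 else 0) (v : Cplx V) :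
    v = ∑ l, pairing B v (e l).conj • e l + ∑ l, pairing B v (e l) • (e l).conj := by
  have symm (v w : Cplx V) : pairing B v w = pairing B w v := by
    apply Complex.ext <;> simp [pairing, hB v.re, hB v.im, add_comm]
  have hee (i j) : pairing B (e i) (e j) = 0 := by
    have h : pairing B (extendLin A (e i)) (extendLin A (e j)) = pairing B (e i) (e j) := by
      simp [pairing, extendLin, hA]
    rw [h₁, h₁] at h
    have h' : pairing B (Complex.I • e i) (Complex.I • e j) = -pairing B (e i) (e j) := by
      apply Complex.ext <;> simp [pairing]
    rw [h'] at h
    linear_combination (-1 / 2 : ℂ) * h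
  have hcc (i j) : pairing B (e i).conj (e j).conj = 0 := by
    have h := hee i j
    rw [Complex.ext_iff] at h ⊢
    simp [pairing, conj] at h ⊢
    constructor <;> linarith
  have hce (i j) : pairing B (e i).conj (e j) = if i = j then 1 else 0 := by
    rw [symm, h₂]; simp [eq_comm]
  let f : Fin n ⊕ Fin n → Cplx V := Sum.elim e (fun i => (e i).conj)
  have hl (c : Fin n ⊕ Fin n → ℂ) (j) : pairing B (∑ i, c i • f i) (e j).conj = c (.inl j) := by
    change pairingLin B (e j).conj _ = _
    rw [map_sum]
    simp only [map_smul]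
    simp [pairingLin, f, h₂, hcc]
  have hr (c : Fin n ⊕ Fin n → ℂ) (j) : pairing B (∑ i, c i • f i) (e j) = c (.inr j) := by
    change pairingLin B (e j) _ = _
    rw [map_sum]
    simp only [map_smul]
    simp [pairingLin, f, hee, hce]
  have hli : LinearIndependent ℂ f := by
    rw [Fintype.linearIndependent_iff]
    intro c hc i
    have h0 (w : Cplx V) : pairing B 0 w = 0 := (pairingLin B w).map_zero
    cases i with
    | inl j => rw [← hl c j, hc, h0]
    | inr j => rw [← hr c j, hc, h0]
  have hspan : v ∈ Submodule.span ℂ (Set.range f) := by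
    rw [hli.span_eq_top_of_card_eq_finrank' (by simp [finrank_eq, hdim, two_mul])]
    trivial
  obtain ⟨c, rfl⟩ := (Submodule.mem_span_range_iff_exists_fun ℂ).1 hspan
  simp only [hl, hr]
  rw [Fintype.sum_sum_type]
  rfl

end Expansion

end Cplx

section Manifold

variable {E : Type*} [NormedAddCommGroup E] [NormedSpace ℝ E] [FiniteDimensional ℝ E]
  {H : Type*} [TopologicalSpace H] {I : ModelWithCorners ℝ E H}
  {M : Type*} [TopologicalSpace M] [ChartedSpace H M] [IsManifold I ∞ M]

/-! ### Almost Hermitian structures -/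

section AlmostHermitian

/-- `J` is a smooth almost complex structure which is orthogonal for the Riemannian metric, so that
`(M, J, g)` is an almost Hermitian manifold. -/
structure IsAlmostHermitian
    (g : ContMDiffRiemannianMetric I ∞ E (fun x : M ↦ TangentSpace I x))
    (J : Π x : M, TangentSpace I x →L[ℝ] TangentSpace I x) : Prop where
  smooth : ContMDiff I (I.prod 𝓘(ℝ, E →L[ℝ] E)) ∞
    (fun x ↦ (TotalSpace.mk' (E →L[ℝ] E) x (J x) :
      TotalSpace (E →L[ℝ] E) (fun x : M ↦ TangentSpace I x →L[ℝ] TangentSpace I x)))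
  sq : ∀ (x : M) (v : TangentSpace I x), J x (J x v) = -v
  orthogonal : ∀ (x : M) (v w : TangentSpace I x), g.inner x (J x v) (J x w) = g.inner x v w

/-- `∇ g = 0`, i.e. `v ⟨Y, Z⟩ = ⟨∇_v Y, Z⟩ + ⟨Y, ∇_v Z⟩`. -/
def IsMetricConnection
    (g : ContMDiffRiemannianMetric I ∞ E (fun x : M ↦ TangentSpace I x))
    (cov : CovariantDerivative I E (TangentSpace I : M → Type _)) : Prop :=
  ∀ (x : M) (Y Z : Π y : M, TangentSpace I y), MDiffAt (T% Y) x → MDiffAt (T% Z) x →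
    ∀ v : TangentSpace I x, d% (fun y ↦ g.inner y (Y y) (Z y)) x v =
      g.inner x (cov Y x v) (Z x) + g.inner x (Y x) (cov Z x v)

/-- The Levi-Civita connection: the (smooth) metric connection without torsion. -/
structure IsLeviCivita
    (g : ContMDiffRiemannianMetric I ∞ E (fun x : M ↦ TangentSpace I x))
    (D : CovariantDerivative I E (TangentSpace I : M → Type _)) : Prop where
  smooth : D.ContMDiffCovariantDerivative ∞
  metric : IsMetricConnection g D
  torsion_free : D.torsion = 0

/-- The canonical connection of an almost Hermitian manifold: the (smooth) connection with
`∇ g = 0`, `∇ J = 0` whose torsion has no `(1,1)`-part, i.e. `τ(v, conj w) = 0` for all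
`(1,0)`-vectors `v`, `w`. -/
structure IsCanonicalConnection
    (g : ContMDiffRiemannianMetric I ∞ E (fun x : M ↦ TangentSpace I x))
    (J : Π x : M, TangentSpace I x →L[ℝ] TangentSpace I x)
    (nab : CovariantDerivative I E (TangentSpace I : M → Type _)) : Prop where
  smooth : nab.ContMDiffCovariantDerivative ∞
  metric : IsMetricConnection g nab
  parallel : ∀ (x : M) (Y : Π y : M, TangentSpace I y), MDiffAt (T% Y) x →
    ∀ v : TangentSpace I x, nab (fun y ↦ J y (Y y)) x v = J x (nab Y x v)
  torsion_one_one : ∀ (x : M) (v w : Cplx (TangentSpace I x)),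
    Cplx.extendLin (J x) v = Complex.I • v → Cplx.extendLin (J x) w = Complex.I • w →
    Cplx.extendBilin (nab.torsion x) v w.conj = 0

/-- `J` is integrable: its Nijenhuis tensor
`N(X, Y) = [JX, JY] - J[JX, Y] - J[X, JY] - [X, Y]` vanishes. -/
def IsIntegrable (J : Π x : M, TangentSpace I x →L[ℝ] TangentSpace I x) : Prop :=
  ∀ (x : M) (X Y : Π y : M, TangentSpace I y), CMDiffAt ∞ (T% X) x → CMDiffAt ∞ (T% Y) x →
    VectorField.mlieBracket I (fun y ↦ J y (X y)) (fun y ↦ J y (Y y)) x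
      - J x (VectorField.mlieBracket I (fun y ↦ J y (X y)) Y x)
      - J x (VectorField.mlieBracket I X (fun y ↦ J y (Y y)) x)
      - VectorField.mlieBracket I X Y x = 0

/-- The nearly Kähler condition `(D_X J) X = D_X (J X) - J (D_X X) = 0` for all vector fields `X`,
where `D` is the Levi-Civita connection. -/
def IsNearlyKahler (J : Π x : M, TangentSpace I x →L[ℝ] TangentSpace I x)
    (D : CovariantDerivative I E (TangentSpace I : M → Type _)) : Prop :=
  ∀ (x : M) (X : Π y : M, TangentSpace I y), CMDiffAt ∞ (T% X) x →
    D (fun y ↦ J y (X y)) x (X x) - J x (D X x (X x)) = 0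

end AlmostHermitian

/-! ### Complex vector fields

A complex vector field is a section `Z` of the complexified tangent bundle. -/

/-- The complex linear extension of a connection: `covC cov Z x w` is `∇_w Z` at `x`, where `Z` is
a complex vector field and `w` a complex tangent vector at `x`. -/
noncomputable def covC (cov : CovariantDerivative I E (TangentSpace I : M → Type _))
    (Z : Π x : M, Cplx (TangentSpace I x)) (x : M) (w : Cplx (TangentSpace I x)) :
    Cplx (TangentSpace I x) :=
  ⟨cov (fun y ↦ (Z y).re) x w.re - cov (fun y ↦ (Z y).im) x w.im,
   cov (fun y ↦ (Z y).im) x w.re + cov (fun y ↦ (Z y).re) x w.im⟩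

/-- The complex bilinear extension of the Lie bracket of vector fields. -/
noncomputable def bracketC (X Y : Π x : M, Cplx (TangentSpace I x)) (x : M) :
    Cplx (TangentSpace I x) :=
  ⟨VectorField.mlieBracket I (fun y ↦ (X y).re) (fun y ↦ (Y y).re) x
      - VectorField.mlieBracket I (fun y ↦ (X y).im) (fun y ↦ (Y y).im) x,
   VectorField.mlieBracket I (fun y ↦ (X y).re) (fun y ↦ (Y y).im) x
      + VectorField.mlieBracket I (fun y ↦ (X y).im) (fun y ↦ (Y y).re) x⟩

/-- The curvature operator `R(X, Y) Z = ∇_X ∇_Y Z - ∇_Y ∇_X Z - ∇_[X,Y] Z` at `x`. -/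
noncomputable def curvatureC (cov : CovariantDerivative I E (TangentSpace I : M → Type _))
    (X Y Z : Π x : M, Cplx (TangentSpace I x)) (x : M) : Cplx (TangentSpace I x) :=
  covC cov (fun y ↦ covC cov Z y (Y y)) x (X x) - covC cov (fun y ↦ covC cov Z y (X y)) x (Y x)
    - covC cov Z x (bracketC X Y x)

/-- The complex bilinear extension of the torsion tensor at `x`. -/
noncomputable def torsionC (cov : CovariantDerivative I E (TangentSpace I : M → Type _)) (x : M)
    (v w : Cplx (TangentSpace I x)) : Cplx (TangentSpace I x) :=
  Cplx.extendBilin (cov.torsion x) v w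

/-- The covariant derivative of the torsion,
`(∇_X τ)(Y, Z) = ∇_X (τ(Y, Z)) - τ(∇_X Y, Z) - τ(Y, ∇_X Z)`, at `x`. -/
noncomputable def covTorsionC (cov : CovariantDerivative I E (TangentSpace I : M → Type _))
    (X Y Z : Π x : M, Cplx (TangentSpace I x)) (x : M) : Cplx (TangentSpace I x) :=
  covC cov (fun y ↦ torsionC cov y (Y y) (Z y)) x (X x)
    - torsionC cov x (covC cov Y x (X x)) (Z x) - torsionC cov x (Y x) (covC cov Z x (X x))

/-! ### Unitary frames and components -/

section Frame

variable {n : ℕ}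

/-- `e₁, …, eₙ` is a smooth local unitary `(1,0)`-frame on `U`, where `2n` is the real dimension:
`J eᵢ = i eᵢ` and `⟨eᵢ, conj eⱼ⟩ = δᵢⱼ`. -/
structure IsUnitaryFrameOn
    (g : ContMDiffRiemannianMetric I ∞ E (fun x : M ↦ TangentSpace I x))
    (J : Π x : M, TangentSpace I x →L[ℝ] TangentSpace I x)
    (e : Fin n → Π x : M, Cplx (TangentSpace I x)) (U : Set M) : Prop where
  smooth_re : ∀ i, CMDiff[U] ∞ (T% (fun x ↦ (e i x).re))
  smooth_im : ∀ i, CMDiff[U] ∞ (T% (fun x ↦ (e i x).im))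
  type_one_zero : ∀ x ∈ U, ∀ i, Cplx.extendLin (J x) (e i x) = Complex.I • e i x
  unitary : ∀ x ∈ U, ∀ i j, Cplx.pairing (g.inner x) (e i x) (e j x).conj = if i = j then 1 else 0

/-- The component `v^l` of `v = v^l e_l + v^{\bar l} conj e_l` in a unitary frame. -/
noncomputable def holComp
    (g : ContMDiffRiemannianMetric I ∞ E (fun x : M ↦ TangentSpace I x))
    (e : Fin n → Π x : M, Cplx (TangentSpace I x)) (x : M)
    (v : Cplx (TangentSpace I x)) (l : Fin n) : ℂ :=
  Cplx.pairing (g.inner x) v (e l x).conj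

/-- The component `v^{\bar l}` of `v = v^l e_l + v^{\bar l} conj e_l` in a unitary frame. -/
noncomputable def antiComp
    (g : ContMDiffRiemannianMetric I ∞ E (fun x : M ↦ TangentSpace I x))
    (e : Fin n → Π x : M, Cplx (TangentSpace I x)) (x : M)
    (v : Cplx (TangentSpace I x)) (l : Fin n) : ℂ :=
  Cplx.pairing (g.inner x) v (e l x)

/-- `holComp` and `antiComp` are the components with respect to the basis `e_l`, `conj e_l`. -/
theorem IsUnitaryFrameOn.eq_sum_comp
    {g : ContMDiffRiemannianMetric I ∞ E (fun x : M ↦ TangentSpace I x)}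
    {J : Π x : M, TangentSpace I x →L[ℝ] TangentSpace I x}
    {e : Fin n → Π x : M, Cplx (TangentSpace I x)} {U : Set M}
    (hdim : Module.finrank ℝ E = 2 * n) (hJ : IsAlmostHermitian g J)
    (he : IsUnitaryFrameOn g J e U) {x : M} (hx : x ∈ U) (v : Cplx (TangentSpace I x)) :
    v = ∑ l, holComp g e x v l • e l x + ∑ l, antiComp g e x v l • (e l x).conj :=
  have : FiniteDimensional ℝ (TangentSpace I x) := inferInstanceAs (FiniteDimensional ℝ E)
  Cplx.eq_sum_pairing (g.inner x) (g.symm x) (J x) (hJ.orthogonal x) hdim (fun i ↦ e i x)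
    (he.type_one_zero x hx) (he.unitary x hx) v

/-- `τ_{kl}^m`. -/
noncomputable def torsionHol
    (g : ContMDiffRiemannianMetric I ∞ E (fun x : M ↦ TangentSpace I x))
    (cov : CovariantDerivative I E (TangentSpace I : M → Type _))
    (e : Fin n → Π x : M, Cplx (TangentSpace I x)) (x : M) (k l m : Fin n) : ℂ :=
  holComp g e x (torsionC cov x (e k x) (e l x)) m

/-- `τ_{kl}^{\bar m}`. -/
noncomputable def torsionAnti
    (g : ContMDiffRiemannianMetric I ∞ E (fun x : M ↦ TangentSpace I x))
    (cov : CovariantDerivative I E (TangentSpace I : M → Type _))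
    (e : Fin n → Π x : M, Cplx (TangentSpace I x)) (x : M) (k l m : Fin n) : ℂ :=
  antiComp g e x (torsionC cov x (e k x) (e l x)) m

/-- `τ_{kl;i}^{\bar m}`, with arguments in the order `k l i m`. -/
noncomputable def covTorsionAnti
    (g : ContMDiffRiemannianMetric I ∞ E (fun x : M ↦ TangentSpace I x))
    (cov : CovariantDerivative I E (TangentSpace I : M → Type _))
    (e : Fin n → Π x : M, Cplx (TangentSpace I x)) (x : M) (k l i m : Fin n) : ℂ :=
  antiComp g e x (covTorsionC cov (e i) (e k) (e l) x) m

/-- `R_{ijkl} = R(e_i, e_j, e_k, e_l) = ⟨R(e_k, e_l) e_i, e_j⟩`. -/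
noncomputable def curvComp
    (g : ContMDiffRiemannianMetric I ∞ E (fun x : M ↦ TangentSpace I x))
    (cov : CovariantDerivative I E (TangentSpace I : M → Type _))
    (e : Fin n → Π x : M, Cplx (TangentSpace I x)) (x : M) (i j k l : Fin n) : ℂ :=
  Cplx.pairing (g.inner x) (curvatureC cov (e k) (e l) (e i) x) (e j x)

end Frame

end Manifold

/-! The canonical connection ∇ preserves type, and g pairs two (1,0)-vectors to zero, so ⟨∇_v e_i,
e_j⟩ = 0. A Koszul argument determines the tensor D − ∇ from the torsion of ∇
(`IsLeviCivita.two_mul_pairing_sub`). Hence the coefficients ⟨D_v e_i, e_j⟩ are pure torsion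
expressions (`two_mul_pairing_levi`). Metricity of D then writes R_{ijkl} through derivatives of
these coefficients, products ⟨D e_i, D e_j⟩ and a bracket term (`curvComp_eq`); the curvature of ∇
never enters.

Replacing derivatives of the components τ_{ab}^{c̄} by covariant derivatives creates terms
containing ∇e. These cancel against the mixed terms of the products and of the bracket.
Differentiation happens along e_k and e_l, whereas the formula also has derivatives along e_i and
e_j; the (0,1)-part of the first Bianchi identity (`bianchi`) converts them, at the price of terms
quadratic in τ. It comes from the Jacobi identity, and is free of curvature because ∇_{e_a}∇_{e_b}
e_c is still of type (1,0).

If J is integrable, brackets of (1,0)-fields are (1,0), so τ_{ab}^{c̄} vanishes on U, and every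
summand of the formula contains such a component or its covariant derivative. If D is nearly Kähler,
the polarized condition on a pair (e, e) makes τ_{ab}^{c̄} totally antisymmetric, and on a pair (e,
ē) it gives τ_{ab}^c = 0. Only covariant derivatives then remain, and four Bianchi identities
without right-hand side cancel them. -/

/-! ### Algebra of the complexification -/

namespace Cplx

section Algebra

variable {V : Type*} [AddCommGroup V]

@[simp] lemma conj_re (v : Cplx V) : v.conj.re = v.re := rfl
@[simp] lemma conj_im (v : Cplx V) : v.conj.im = -v.im := rfl

variable [Module ℝ V] [TopologicalSpace V]

@[simp] lemma extendLin_re (A : V →L[ℝ] V) (v : Cplx V) : (extendLin A v).re = A v.re := rfl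
@[simp] lemma extendLin_im (A : V →L[ℝ] V) (v : Cplx V) : (extendLin A v).im = A v.im := rfl

lemma extendLin_conj_of_eq {A : V →L[ℝ] V} {v : Cplx V} (h : extendLin A v = Complex.I • v) :
    extendLin A v.conj = (-Complex.I) • v.conj := by
  have h1 := congrArg re h
  have h2 := congrArg im h
  simp at h1 h2
  ext <;> simp [h1, h2]

variable [IsTopologicalAddGroup V] [ContinuousSMul ℝ V]

section Bilin

variable (B : V →L[ℝ] V →L[ℝ] V)

@[simp] lemma extendBilin_re (v w : Cplx V) :
    (extendBilin B v w).re = B v.re w.re - B v.im w.im := rfl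
@[simp] lemma extendBilin_im (v w : Cplx V) :
    (extendBilin B v w).im = B v.re w.im + B v.im w.re := rfl

/-- The complex bilinear extension, as a bilinear map. -/
noncomputable def extendBilinₗ : Cplx V →ₗ[ℂ] Cplx V →ₗ[ℂ] Cplx V :=
  LinearMap.mk₂ ℂ (extendBilin B)
    (fun u v w => by ext <;> simp <;> module)
    (fun c v w => by ext <;> simp <;> module)
    (fun u v w => by ext <;> simp <;> module)
    (fun c v w => by ext <;> simp <;> module)

end Bilin

section Pairing

variable (B : V →L[ℝ] V →L[ℝ] ℝ)

@[simp] lemma pairing_re (v w : Cplx V) : (pairing B v w).re = B v.re w.re - B v.im w.im := rfl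
@[simp] lemma pairing_im (v w : Cplx V) : (pairing B v w).im = B v.re w.im + B v.im w.re := rfl

/-- The complex bilinear extension of a real bilinear form, as a bilinear form. -/
noncomputable def pairingₗ : Cplx V →ₗ[ℂ] Cplx V →ₗ[ℂ] ℂ :=
  LinearMap.mk₂ ℂ (pairing B)
    (fun u v w => by apply Complex.ext <;> simp <;> ring)
    (fun c v w => by apply Complex.ext <;> simp <;> ring)
    (fun u v w => by apply Complex.ext <;> simp <;> ring)
    (fun c v w => by apply Complex.ext <;> simp <;> ring)

lemma pairing_eq (v w : Cplx V) : pairing B v w = pairingₗ B v w := rfl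

variable {B}

lemma pairing_comm (hB : ∀ v w, B v w = B w v) (v w : Cplx V) :
    pairing B v w = pairing B w v := by
  apply Complex.ext <;> simp [hB v.re, hB v.im, add_comm]

variable {A : V →L[ℝ] V}

lemma pairing_extendLin_extendLin (hA : ∀ v w, B (A v) (A w) = B v w) (v w : Cplx V) :
    pairing B (extendLin A v) (extendLin A w) = pairing B v w := by
  apply Complex.ext <;> simp [hA]

/-- Two vectors of type `(1,0)` are orthogonal for the complex bilinear extension of the metric. -/
lemma pairing_eq_zero (hA : ∀ v w, B (A v) (A w) = B v w) {v w : Cplx V}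
    (hv : extendLin A v = Complex.I • v) (hw : extendLin A w = Complex.I • w) :
    pairing B v w = 0 := by
  have h := pairing_extendLin_extendLin hA v w
  rw [hv, hw] at h
  simp only [pairing_eq, map_smul, LinearMap.smul_apply, smul_eq_mul] at h ⊢
  -- `h` says i² ⟨v, w⟩ = ⟨v, w⟩.
  linear_combination (-1 / 2 : ℂ) * h + (1 / 2 : ℂ) * pairingₗ B v w * Complex.I_mul_I

/-- An orthogonal complex structure moves past a vector of type `(1,0)` as `-i`. -/
lemma pairing_extendLin_left (hA : ∀ v w, B (A v) (A w) = B v w) (v : Cplx V) {w : Cplx V}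
    (hw : extendLin A w = Complex.I • w) :
    pairing B (extendLin A v) w = -Complex.I * pairing B v w := by
  have h := pairing_extendLin_extendLin hA v w
  rw [hw] at h
  simp only [pairing_eq, map_smul, smul_eq_mul] at h ⊢
  linear_combination -Complex.I * h + pairingₗ B (extendLin A v) w * Complex.I_mul_I

end Pairing

end Algebra

end Cplx

/-! ### Smoothness of real vector fields, brackets and covariant derivatives -/

section RealCalculus

open scoped Topology

variable {E : Type*} [NormedAddCommGroup E] [NormedSpace ℝ E]
  {H : Type*} [TopologicalSpace H] {I : ModelWithCorners ℝ E H}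
  {M : Type*} [TopologicalSpace M] [ChartedSpace H M] [IsManifold I ∞ M]

lemma mdifferentiableAt_of_contMDiffOn {U : Set M} (hU : IsOpen U) {x : M} (hx : x ∈ U)
    {X : Π y : M, TangentSpace I y} (hX : CMDiff[U] ∞ (T% X)) : MDiffAt (T% X) x :=
  ((hX x hx).contMDiffAt (hU.mem_nhds hx)).mdifferentiableAt (by simp)

/-- The scalar product of two differentiable vector fields is differentiable. -/
lemma mdifferentiableAt_metric (g : ContMDiffRiemannianMetric I ∞ E (fun x : M ↦ TangentSpace I x))
    {x : M} {Y Z : Π y : M, TangentSpace I y} (hY : MDiffAt (T% Y) x) (hZ : MDiffAt (T% Z) x) :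
    MDiffAt (fun y ↦ g.inner y (Y y) (Z y)) x := by
  have : MDifferentiableAt I (I.prod 𝓘(ℝ))
      (fun m ↦ TotalSpace.mk' ℝ (E := Bundle.Trivial M ℝ) m (g.inner m (Y m) (Z m))) x := by
    apply MDifferentiableAt.clm_bundle_apply₂ (F₁ := E) (F₂ := E)
    · exact g.contMDiff.mdifferentiableAt (by simp)
    · exact hY
    · exact hZ
  simp only [mdifferentiableAt_totalSpace] at this
  exact this.2

lemma contMDiffOn_clm_apply {U : Set M} {A : Π x : M, TangentSpace I x →L[ℝ] TangentSpace I x}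
    (hA : ContMDiffOn I (I.prod 𝓘(ℝ, E →L[ℝ] E)) ∞
    (fun x ↦ (TotalSpace.mk' (E →L[ℝ] E) x (A x) :
      TotalSpace (E →L[ℝ] E) (fun x : M ↦ TangentSpace I x →L[ℝ] TangentSpace I x))) U)
    {X : Π y : M, TangentSpace I y} (hX : CMDiff[U] ∞ (T% X)) :
    CMDiff[U] ∞ (T% (fun y ↦ A y (X y))) :=
  ContMDiffOn.clm_bundle_apply (F₁ := E) (F₂ := E) hA hX

variable [FiniteDimensional ℝ E]

lemma contMDiffOn_mlieBracket {U : Set M} (hU : IsOpen U)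
    {X Y : Π y : M, TangentSpace I y} (hX : CMDiff[U] ∞ (T% X)) (hY : CMDiff[U] ∞ (T% Y)) :
    CMDiff[U] ∞ (T% (VectorField.mlieBracket I X Y)) := by
  have : IsManifold I (((⊤ : ℕ∞) : ℕ∞ω) + 1) M := by
    have h : (((⊤ : ℕ∞) : ℕ∞ω) + 1) = ∞ := rfl
    rw [h]; infer_instance
  have : IsManifold I (minSmoothness ℝ 2) M := by
    rw [minSmoothness_of_isRCLikeNormedField]; infer_instance
  intro x hx
  refine (ContMDiffAt.mlieBracket_vectorField (m := ⊤) (n := ⊤) ((hX x hx).contMDiffAt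
    (hU.mem_nhds hx)) ((hY x hx).contMDiffAt (hU.mem_nhds hx)) ?_).contMDiffWithinAt
  simp

/-- A smooth connection maps vector fields that are smooth on an open set to sections that are
smooth there. -/
lemma CovariantDerivative.ContMDiffCovariantDerivative.contMDiffOn [T2Space M]
    {cov : CovariantDerivative I E (TangentSpace I : M → Type _)}
    (hcov : cov.ContMDiffCovariantDerivative ∞) {U : Set M} (hU : IsOpen U)
    {X : Π y : M, TangentSpace I y} (hX : CMDiff[U] ∞ (T% X)) :
    ContMDiffOn I (I.prod 𝓘(ℝ, E →L[ℝ] E)) ∞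
    (fun x ↦ (TotalSpace.mk' (E →L[ℝ] E) x (cov X x) :
      TotalSpace (E →L[ℝ] E) (fun x : M ↦ TangentSpace I x →L[ℝ] TangentSpace I x))) U := by
  intro p hp
  -- Smoothness of `cov` concerns globally smooth sections, so `X` is cut off by a bump function
  -- supported in `U` and equal to 1 near `p`; locality of `cov` then removes the cutoff.
  obtain ⟨f, -, hf⟩ :=
    (SmoothBumpFunction.nhds_basis_tsupport (I := I) p).mem_iff.1 (hU.mem_nhds hp)
  have hfX : CMDiff ∞ (T% (fun y ↦ f y • X y)) := by
    intro y
    by_cases hy : y ∈ U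
    · exact (f.contMDiff.contMDiffAt).smul_section ((hX y hy).contMDiffAt (hU.mem_nhds hy))
    · have h0 : (tsupport f)ᶜ ∈ 𝓝 y :=
        (isClosed_tsupport f).isOpen_compl.mem_nhds (fun h ↦ hy (hf h))
      refine (Bundle.contMDiff_zeroSection ℝ
        (TangentSpace I : M → Type _)).contMDiffAt.congr_of_eventuallyEq ?_
      filter_upwards [h0] with z hz
      simp [image_eq_zero_of_notMem_tsupport hz, zeroSection]
  have hc : ContMDiffOn _ _ _ _ _ :=
    hcov.contMDiff.contMDiff (σ := fun y ↦ f y • X y) hfX.contMDiffOn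
  refine ((hc p trivial).contMDiffAt Filter.univ_mem).congr_of_eventuallyEq ?_ |>.contMDiffWithinAt
  filter_upwards [f.eventuallyEq_one.eventuallyEq_nhds, hU.mem_nhds hp] with y hy hyU
  congr 1
  refine cov.isCovariantDerivativeOnUniv.congr_of_eventuallyEq
    (mdifferentiableAt_of_contMDiffOn hU hyU hX) (hfX.mdifferentiable (by simp) y)
    Filter.univ_mem ?_
  filter_upwards [hy] with z hz
  simp [hz]

end RealCalculus

/-! ### Calculus of complex vector fields -/

section ComplexCalculus

open VectorField
open scoped Topology

variable {E : Type*} [NormedAddCommGroup E] [NormedSpace ℝ E]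
  {H : Type*} [TopologicalSpace H] {I : ModelWithCorners ℝ E H}
  {M : Type*} [TopologicalSpace M] [ChartedSpace H M]

section Differential

/-- The complex linear extension of the differential of a complex function. -/
noncomputable def diffC (f : M → ℂ) (x : M) (w : Cplx (TangentSpace I x)) : ℂ :=
  ⟨d% (fun y ↦ (f y).re) x w.re - d% (fun y ↦ (f y).im) x w.im,
   d% (fun y ↦ (f y).im) x w.re + d% (fun y ↦ (f y).re) x w.im⟩

variable (I) in
/-- The real and imaginary parts of a complex function are differentiable. -/
structure FunMDiffAtC (f : M → ℂ) (x : M) : Prop where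
  re : MDiffAt (fun y ↦ (f y).re) x
  im : MDiffAt (fun y ↦ (f y).im) x

variable {f h : M → ℂ} {x : M}

lemma mvfderiv_congr {u v : M → ℝ} (huv : u =ᶠ[𝓝 x] v) : d% u x = d% v x := by
  ext w
  simp only [mvfderiv]
  rw [huv.mfderiv_eq, huv.eq_of_nhds]

lemma diffC_congr (hfh : f =ᶠ[𝓝 x] h) (w : Cplx (TangentSpace I x)) :
    diffC f x w = diffC h x w := by
  have h1 : d% (fun y ↦ (f y).re) x = d% (fun y ↦ (h y).re) x :=
    mvfderiv_congr (hfh.fun_comp Complex.re)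
  have h2 : d% (fun y ↦ (f y).im) x = d% (fun y ↦ (h y).im) x :=
    mvfderiv_congr (hfh.fun_comp Complex.im)
  simp only [diffC, h1, h2]

lemma diffC_add (hf : FunMDiffAtC I f x) (hh : FunMDiffAtC I h x) (w : Cplx (TangentSpace I x)) :
    diffC (fun y ↦ f y + h y) x w = diffC f x w + diffC h x w := by
  apply Complex.ext <;>
    simp [diffC, mvfderiv_fun_add hf.re hh.re, mvfderiv_fun_add hf.im hh.im] <;> ring

lemma diffC_sub (hf : FunMDiffAtC I f x) (hh : FunMDiffAtC I h x) (w : Cplx (TangentSpace I x)) :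
    diffC (fun y ↦ f y - h y) x w = diffC f x w - diffC h x w := by
  apply Complex.ext <;>
    simp [diffC, mvfderiv_fun_sub hf.re hh.re, mvfderiv_fun_sub hf.im hh.im] <;> ring

lemma FunMDiffAtC.sub (hf : FunMDiffAtC I f x) (hh : FunMDiffAtC I h x) :
    FunMDiffAtC I (fun y ↦ f y - h y) x :=
  ⟨hf.re.sub hh.re, hf.im.sub hh.im⟩

lemma diffC_zero (w : Cplx (TangentSpace I x)) : diffC (fun _ ↦ 0) x w = 0 := by
  apply Complex.ext <;> simp [diffC, mvfderiv_const]

lemma diffC_neg (w : Cplx (TangentSpace I x)) : diffC (fun y ↦ -f y) x w = -diffC f x w := by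
  apply Complex.ext <;> simp [diffC, mvfderiv_fun_neg] <;> ring

end Differential

variable [IsManifold I ∞ M]

/-- A complex vector field is differentiable at a point if its real and imaginary parts are. -/
structure MDiffAtC (Z : Π x : M, Cplx (TangentSpace I x)) (x : M) : Prop where
  re : MDiffAt (T% (fun y ↦ (Z y).re)) x
  im : MDiffAt (T% (fun y ↦ (Z y).im)) x

/-- A complex vector field is smooth on a set if its real and imaginary parts are. -/
structure SmoothOnC (Z : Π x : M, Cplx (TangentSpace I x)) (U : Set M) : Prop where
  re : CMDiff[U] ∞ (T% (fun y ↦ (Z y).re))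
  im : CMDiff[U] ∞ (T% (fun y ↦ (Z y).im))

variable {U : Set M} {x : M} {X Y Z : Π x : M, Cplx (TangentSpace I x)}

lemma SmoothOnC.mdiffAtC (hZ : SmoothOnC Z U) (hU : IsOpen U) (hx : x ∈ U) : MDiffAtC Z x :=
  ⟨mdifferentiableAt_of_contMDiffOn hU hx hZ.re, mdifferentiableAt_of_contMDiffOn hU hx hZ.im⟩

lemma SmoothOnC.sub (hY : SmoothOnC Y U) (hZ : SmoothOnC Z U) :
    SmoothOnC (fun y ↦ Y y - Z y) U :=
  ⟨ContMDiffOn.sub_section hY.re hZ.re, ContMDiffOn.sub_section hY.im hZ.im⟩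

lemma SmoothOnC.conj (hZ : SmoothOnC Z U) : SmoothOnC (fun y ↦ (Z y).conj) U :=
  ⟨hZ.re, ContMDiffOn.neg_section hZ.im⟩

lemma SmoothOnC.congr (hY : SmoothOnC Y U) (h : ∀ x ∈ U, Z x = Y x) : SmoothOnC Z U :=
  ⟨hY.re.congr fun x hx ↦ by simp [h x hx], hY.im.congr fun x hx ↦ by simp [h x hx]⟩

/-- Every complex tangent vector extends to a differentiable vector field. -/
lemma exists_mdiffAtC (v : Cplx (TangentSpace I x)) :
    ∃ X : Π x : M, Cplx (TangentSpace I x), X x = v ∧ MDiffAtC X x := by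
  refine ⟨fun y ↦ ⟨FiberBundle.extend E v.re y, FiberBundle.extend E v.im y⟩, ?_, ?_, ?_⟩
  · ext <;> simp
  · exact FiberBundle.mdifferentiableAt_extend ..
  · exact FiberBundle.mdifferentiableAt_extend ..

lemma funMDiffAtC_pairing (g : ContMDiffRiemannianMetric I ∞ E (fun x : M ↦ TangentSpace I x))
    (hY : MDiffAtC Y x) (hZ : MDiffAtC Z x) :
    FunMDiffAtC I (fun y ↦ Cplx.pairing (g.inner y) (Y y) (Z y)) x :=
  ⟨(mdifferentiableAt_metric g hY.re hZ.re).sub (mdifferentiableAt_metric g hY.im hZ.im),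
    (mdifferentiableAt_metric g hY.re hZ.im).add (mdifferentiableAt_metric g hY.im hZ.re)⟩

variable {cov : CovariantDerivative I E (TangentSpace I : M → Type _)}

section Real

variable {σ τ : Π x : M, TangentSpace I x}

lemma cov_fun_add (hσ : MDiffAt (T% σ) x) (hτ : MDiffAt (T% τ) x) :
    cov (fun y ↦ σ y + τ y) x = cov σ x + cov τ x :=
  cov.isCovariantDerivativeOnUniv.add hσ hτ

lemma cov_fun_neg (hσ : MDiffAt (T% σ) x) : cov (fun y ↦ -σ y) x = -cov σ x := by
  have h := cov.isCovariantDerivativeOnUniv.smul_const (-1 : ℝ) hσ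
  rw [neg_one_smul, neg_one_smul] at h
  exact h

lemma cov_fun_sub (hσ : MDiffAt (T% σ) x) (hτ : MDiffAt (T% τ) x) :
    cov (fun y ↦ σ y - τ y) x = cov σ x - cov τ x := by
  have h := cov_fun_add (cov := cov) hσ (mdifferentiableAt_neg_section hτ)
  have h' := cov_fun_neg (cov := cov) hτ
  simp only [sub_eq_add_neg]
  rw [← h']
  exact h

lemma cov_congr (hσ : MDiffAt (T% σ) x) (hτ : MDiffAt (T% τ) x) (h : ∀ᶠ y in 𝓝 x, σ y = τ y) :
    cov σ x = cov τ x :=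
  cov.isCovariantDerivativeOnUniv.congr_of_eventuallyEq hσ hτ Filter.univ_mem h

end Real

lemma covC_sub (hY : MDiffAtC Y x) (hZ : MDiffAtC Z x) (w : Cplx (TangentSpace I x)) :
    covC cov (fun y ↦ Y y - Z y) x w = covC cov Y x w - covC cov Z x w := by
  ext <;> simp [covC, cov_fun_sub hY.re hZ.re, cov_fun_sub hY.im hZ.im] <;> abel

lemma covC_congr (hY : MDiffAtC Y x) (hZ : MDiffAtC Z x) (h : ∀ᶠ y in 𝓝 x, Y y = Z y)
    (w : Cplx (TangentSpace I x)) : covC cov Y x w = covC cov Z x w := by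
  have h1 := cov_congr (cov := cov) hY.re hZ.re (h.mono fun y hy ↦ by rw [hy])
  have h2 := cov_congr (cov := cov) hY.im hZ.im (h.mono fun y hy ↦ by rw [hy])
  simp only [covC, h1, h2]

/-- The product rule for a metric connection and complex vector fields. -/
lemma IsMetricConnection.diffC_pairing
    {g : ContMDiffRiemannianMetric I ∞ E (fun x : M ↦ TangentSpace I x)}
    (hcov : IsMetricConnection g cov) (hY : MDiffAtC Y x) (hZ : MDiffAtC Z x)
    (w : Cplx (TangentSpace I x)) :
    diffC (fun y ↦ Cplx.pairing (g.inner y) (Y y) (Z y)) x w =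
      Cplx.pairing (g.inner x) (covC cov Y x w) (Z x)
        + Cplx.pairing (g.inner x) (Y x) (covC cov Z x w) := by
  have d1 := mvfderiv_fun_sub (mdifferentiableAt_metric g hY.re hZ.re)
    (mdifferentiableAt_metric g hY.im hZ.im)
  have d2 := mvfderiv_fun_add (mdifferentiableAt_metric g hY.re hZ.im)
    (mdifferentiableAt_metric g hY.im hZ.re)
  have h1 := hcov x _ _ hY.re hZ.re
  have h2 := hcov x _ _ hY.im hZ.im
  have h3 := hcov x _ _ hY.re hZ.im
  have h4 := hcov x _ _ hY.im hZ.re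
  apply Complex.ext <;>
    simp [diffC, covC, d1, d2, h1, h2, h3, h4] <;> ring

variable [FiniteDimensional ℝ E]

lemma SmoothOnC.covC [T2Space M] (hcov : cov.ContMDiffCovariantDerivative ∞) (hU : IsOpen U)
    (hY : SmoothOnC Y U) (hZ : SmoothOnC Z U) : SmoothOnC (fun y ↦ covC cov Z y (Y y)) U := by
  have h1 := hcov.contMDiffOn hU hZ.re
  have h2 := hcov.contMDiffOn hU hZ.im
  exact ⟨(contMDiffOn_clm_apply h1 hY.re).sub_section (contMDiffOn_clm_apply h2 hY.im),
    (contMDiffOn_clm_apply h2 hY.re).add_section (contMDiffOn_clm_apply h1 hY.im)⟩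

lemma SmoothOnC.bracketC (hU : IsOpen U)
    (hY : SmoothOnC Y U) (hZ : SmoothOnC Z U) : SmoothOnC (bracketC Y Z) U :=
  ⟨(contMDiffOn_mlieBracket hU hY.re hZ.re).sub_section (contMDiffOn_mlieBracket hU hY.im hZ.im),
    (contMDiffOn_mlieBracket hU hY.re hZ.im).add_section (contMDiffOn_mlieBracket hU hY.im hZ.re)⟩

lemma torsionC_eq (hX : MDiffAtC X x) (hY : MDiffAtC Y x) :
    torsionC cov x (X x) (Y x) = covC cov Y x (X x) - covC cov X x (Y x) - bracketC X Y x := by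
  have h1 := cov.torsion_apply hX.re hY.re
  have h2 := cov.torsion_apply hX.im hY.im
  have h3 := cov.torsion_apply hX.re hY.im
  have h4 := cov.torsion_apply hX.im hY.re
  ext <;> simp [torsionC, covC, bracketC, h1, h2, h3, h4] <;> abel

lemma torsionC_antisymm (v w : Cplx (TangentSpace I x)) :
    torsionC cov x v w = -torsionC cov x w v := by
  ext
  · simp [torsionC, cov.torsion_antisymm v.re, cov.torsion_antisymm v.im]
    abel
  · simp [torsionC, cov.torsion_antisymm v.re, cov.torsion_antisymm v.im, add_comm]

lemma torsionC_eq_zero (h : cov.torsion = 0) (v w : Cplx (TangentSpace I x)) :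
    torsionC cov x v w = 0 := by
  ext <;> simp [torsionC, h]

/-- The Leibniz identity for the bracket, made cyclic by one swap of an inner and one of an outer
bracket. -/
lemma mlieBracket_jacobi (hU : IsOpen U) (hx : x ∈ U) {u v w : Π x : M, TangentSpace I x}
    (hu : CMDiff[U] ∞ (T% u)) (hv : CMDiff[U] ∞ (T% v)) (hw : CMDiff[U] ∞ (T% w)) :
    mlieBracket I u (mlieBracket I v w) x
      + mlieBracket I v (mlieBracket I w u) x
      + mlieBracket I w (mlieBracket I u v) x = 0 := by
  have h3 : minSmoothness ℝ 3 = 3 := minSmoothness_of_isRCLikeNormedField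
  have h2 : minSmoothness ℝ 2 ≤ ∞ := by
    rw [minSmoothness_of_isRCLikeNormedField]; exact ENat.LEInfty.out
  have : IsManifold I (minSmoothness ℝ 3) M := by rw [h3]; infer_instance
  have hn := hU.mem_nhds hx
  have h := leibniz_identity_mlieBracket_apply (I := I) (x := x)
    (((hu x hx).contMDiffAt hn).of_le h2) (((hv x hx).contMDiffAt hn).of_le h2)
    (((hw x hx).contMDiffAt hn).of_le h2)
  have hwu : mlieBracket I v (mlieBracket I u w) x
      = -mlieBracket I v (mlieBracket I w u) x := by
    have := mlieBracket_const_smul_right (c := (-1 : ℝ)) (V := v)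
      (mdifferentiableAt_of_contMDiffOn hU hx (contMDiffOn_mlieBracket hU hw hu))
    rw [neg_one_smul, neg_one_smul, ← mlieBracket_swap] at this
    exact this
  rw [h, hwu, mlieBracket_swap_apply (V := mlieBracket I u v)]
  abel

/-- The outer bracket splits `X` by definition, but is additive in its second argument only on
differentiable fields; so smoothness matters for `Y` and `Z` alone. -/
lemma bracketC_bracketC (hU : IsOpen U) (hx : x ∈ U)
    (X : Π x : M, Cplx (TangentSpace I x)) (hY : SmoothOnC Y U) (hZ : SmoothOnC Z U) :
    bracketC X (bracketC Y Z) x =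
      ⟨mlieBracket I (fun y ↦ (X y).re)
          (mlieBracket I (fun y ↦ (Y y).re) (fun y ↦ (Z y).re)) x
        - mlieBracket I (fun y ↦ (X y).re)
          (mlieBracket I (fun y ↦ (Y y).im) (fun y ↦ (Z y).im)) x
        - mlieBracket I (fun y ↦ (X y).im)
          (mlieBracket I (fun y ↦ (Y y).re) (fun y ↦ (Z y).im)) x
        - mlieBracket I (fun y ↦ (X y).im)
          (mlieBracket I (fun y ↦ (Y y).im) (fun y ↦ (Z y).re)) x,
      mlieBracket I (fun y ↦ (X y).re)
          (mlieBracket I (fun y ↦ (Y y).re) (fun y ↦ (Z y).im)) x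
        + mlieBracket I (fun y ↦ (X y).re)
          (mlieBracket I (fun y ↦ (Y y).im) (fun y ↦ (Z y).re)) x
        + mlieBracket I (fun y ↦ (X y).im)
          (mlieBracket I (fun y ↦ (Y y).re) (fun y ↦ (Z y).re)) x
        - mlieBracket I (fun y ↦ (X y).im)
          (mlieBracket I (fun y ↦ (Y y).im) (fun y ↦ (Z y).im)) x⟩ := by
  have d {u v : Π x : M, TangentSpace I x} (hu : CMDiff[U] ∞ (T% u)) (hv : CMDiff[U] ∞ (T% v)) :
      MDiffAt (T% (mlieBracket I u v)) x :=
    mdifferentiableAt_of_contMDiffOn hU hx (contMDiffOn_mlieBracket hU hu hv)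
  have hadd (w : Π x : M, TangentSpace I x) :
      mlieBracket I w (fun y ↦ (bracketC Y Z y).im) x = _ :=
    mlieBracket_add_right (d hY.re hZ.im) (d hY.im hZ.re)
  have hsub (w : Π x : M, TangentSpace I x) :
      mlieBracket I w (fun y ↦ (bracketC Y Z y).re) x =
        mlieBracket I w (mlieBracket I (fun y ↦ (Y y).re) (fun y ↦ (Z y).re)) x
        - mlieBracket I w (mlieBracket I (fun y ↦ (Y y).im) (fun y ↦ (Z y).im)) x := by
    have h1 := mlieBracket_add_right (V := w) (d hY.re hZ.re)
      (mdifferentiableAt_neg_section (d hY.im hZ.im))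
    have h2 := mlieBracket_const_smul_right (c := (-1 : ℝ)) (V := w) (d hY.im hZ.im)
    rw [neg_one_smul, neg_one_smul] at h2
    rw [h2, ← sub_eq_add_neg, ← sub_eq_add_neg] at h1
    exact h1
  ext
  · simp only [bracketC] at hadd hsub ⊢
    rw [hadd, hsub]
    abel
  · simp only [bracketC] at hadd hsub ⊢
    rw [hadd, hsub]
    abel

/-- The Jacobi identity for complex vector fields. -/
lemma bracketC_jacobi (hU : IsOpen U) (hx : x ∈ U)
    (hX : SmoothOnC X U) (hY : SmoothOnC Y U) (hZ : SmoothOnC Z U) :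
    bracketC X (bracketC Y Z) x + bracketC Y (bracketC Z X) x
      + bracketC Z (bracketC X Y) x = 0 := by
  rw [bracketC_bracketC hU hx X hY hZ, bracketC_bracketC hU hx Y hZ hX,
    bracketC_bracketC hU hx Z hX hY]
  ext
  · simp only [Cplx.add_re, Cplx.zero_re]
    -- Real part of a trilinear expression: two imaginary entries contribute the sign i² = −1.
    -- Likewise three imaginary entries in the imaginary part below.
    linear_combination (norm := abel) mlieBracket_jacobi hU hx hX.re hY.re hZ.re
      - mlieBracket_jacobi hU hx hX.re hY.im hZ.im
      - mlieBracket_jacobi hU hx hX.im hY.re hZ.im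
      - mlieBracket_jacobi hU hx hX.im hY.im hZ.re
  · simp only [Cplx.add_im, Cplx.zero_im]
    linear_combination (norm := abel) mlieBracket_jacobi hU hx hX.re hY.re hZ.im
      + mlieBracket_jacobi hU hx hX.re hY.im hZ.re
      + mlieBracket_jacobi hU hx hX.im hY.re hZ.re
      - mlieBracket_jacobi hU hx hX.im hY.im hZ.im

end ComplexCalculus

/-! ### The canonical connection in a unitary frame -/

section CanonicalConnection

open scoped Topology

variable {E : Type*} [NormedAddCommGroup E] [NormedSpace ℝ E] [FiniteDimensional ℝ E]
  {H : Type*} [TopologicalSpace H] {I : ModelWithCorners ℝ E H}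
  {M : Type*} [TopologicalSpace M] [ChartedSpace H M] [IsManifold I ∞ M]
  {g : ContMDiffRiemannianMetric I ∞ E (fun x : M ↦ TangentSpace I x)}
  {J : Π x : M, TangentSpace I x →L[ℝ] TangentSpace I x}
  {D nab : CovariantDerivative I E (TangentSpace I : M → Type _)}

/-- The torsion with lowered index, `(u, v, w) ↦ ⟨τ(u, v), w⟩`, extended complex trilinearly. -/
noncomputable def torsionForm (g : ContMDiffRiemannianMetric I ∞ E (fun x : M ↦ TangentSpace I x))
    (cov : CovariantDerivative I E (TangentSpace I : M → Type _)) (x : M) :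
    Cplx (TangentSpace I x) →ₗ[ℂ] Cplx (TangentSpace I x) →ₗ[ℂ] Cplx (TangentSpace I x) →ₗ[ℂ] ℂ :=
  (Cplx.extendBilinₗ (cov.torsion x)).compr₂ (Cplx.pairingₗ (g.inner x))

lemma torsionForm_apply {cov : CovariantDerivative I E (TangentSpace I : M → Type _)} {x : M}
    (u v w : Cplx (TangentSpace I x)) :
    torsionForm g cov x u v w = Cplx.pairing (g.inner x) (torsionC cov x u v) w := rfl

lemma torsionForm_antisymm {cov : CovariantDerivative I E (TangentSpace I : M → Type _)} {x : M}
    (u v w : Cplx (TangentSpace I x)) :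
    torsionForm g cov x u v w = -torsionForm g cov x v u w := by
  rw [torsionForm_apply, torsionForm_apply, torsionC_antisymm, Cplx.pairing_eq, Cplx.pairing_eq,
    map_neg, LinearMap.neg_apply]

/-- The difference of the Levi-Civita connection and a metric connection in terms of the torsion
of the latter. -/
lemma IsLeviCivita.two_mul_pairing_sub (hD : IsLeviCivita g D) (hnab : IsMetricConnection g nab)
    {x : M} {Y : Π x : M, Cplx (TangentSpace I x)} (hY : MDiffAtC Y x)
    (v w : Cplx (TangentSpace I x)) :
    2 * Cplx.pairing (g.inner x) (covC D Y x v - covC nab Y x v) w =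
      torsionForm g nab x (Y x) w v - torsionForm g nab x v (Y x) w
        - torsionForm g nab x w v (Y x) := by
  -- Both sides depend only on the values of `v` and `w` at `x`, so these may be extended to fields,
  -- as torsion and metricity require.
  obtain ⟨X, rfl, hX⟩ := exists_mdiffAtC v
  obtain ⟨Z, rfl, hZ⟩ := exists_mdiffAtC w
  have comm := Cplx.pairing_comm (g.symm x)
  -- Put A = D − ∇. Both connections being metric, ⟨A_X Y, Z⟩ is skew in Y and Z.
  have anti {X Y Z : Π x : M, Cplx (TangentSpace I x)} (hY : MDiffAtC Y x)
      (hZ : MDiffAtC Z x) :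
      Cplx.pairing (g.inner x) (covC D Y x (X x) - covC nab Y x (X x)) (Z x) =
        -Cplx.pairing (g.inner x) (covC D Z x (X x) - covC nab Z x (X x)) (Y x) := by
    have h1 := hD.metric.diffC_pairing hY hZ (X x)
    have h2 := hnab.diffC_pairing hY hZ (X x)
    rw [comm (Y x)] at h1 h2
    simp only [Cplx.pairing_eq, map_sub, LinearMap.sub_apply] at h1 h2 ⊢
    linear_combination h2 - h1
  -- As D has no torsion, τ(X, Y) = A_Y X − A_X Y.
  have tor {X Y : Π x : M, Cplx (TangentSpace I x)} (hX : MDiffAtC X x) (hY : MDiffAtC Y x)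
      (w : Cplx (TangentSpace I x)) :
      torsionForm g nab x (X x) (Y x) w =
        Cplx.pairing (g.inner x) (covC D X x (Y x) - covC nab X x (Y x)) w
        - Cplx.pairing (g.inner x) (covC D Y x (X x) - covC nab Y x (X x)) w := by
    have h1 := torsionC_eq (cov := D) hX hY
    rw [torsionC_eq_zero hD.torsion_free] at h1
    have h1' := congrArg (fun u ↦ Cplx.pairingₗ (g.inner x) u w) h1
    rw [torsionForm_apply, torsionC_eq hX hY]
    simp only [Cplx.pairing_eq, map_sub, LinearMap.sub_apply, map_zero, LinearMap.zero_apply]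
      at h1' ⊢
    linear_combination -h1'
  -- Koszul's trick: the three torsion terms give six values of A, which skewness reduces to 2⟨A_X
  -- Y, Z⟩.
  rw [tor hY hZ, tor hX hY, tor hZ hX]
  linear_combination anti (X := X) hY hZ + anti (X := Y) hX hZ - anti (X := Z) hX hY

/-- The canonical connection preserves the type of vector fields. -/
lemma IsCanonicalConnection.extendLin_covC (hnab : IsCanonicalConnection g J nab)
    (hJ : IsAlmostHermitian g J) {U : Set M} (hU : IsOpen U)
    {Z : Π x : M, Cplx (TangentSpace I x)} (hZ : SmoothOnC Z U)
    (hZJ : ∀ x ∈ U, Cplx.extendLin (J x) (Z x) = Complex.I • Z x) {x : M} (hx : x ∈ U)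
    (w : Cplx (TangentSpace I x)) :
    Cplx.extendLin (J x) (covC nab Z x w) = Complex.I • covC nab Z x w := by
  have hd := hZ.mdiffAtC hU hx
  have hdre := mdifferentiableAt_of_contMDiffOn hU hx
    (contMDiffOn_clm_apply hJ.smooth.contMDiffOn hZ.re)
  have hdim := mdifferentiableAt_of_contMDiffOn hU hx
    (contMDiffOn_clm_apply hJ.smooth.contMDiffOn hZ.im)
  have hre : ∀ y ∈ U, J y (Z y).re = -(Z y).im := fun y hy ↦ by
    simpa using congrArg Cplx.re (hZJ y hy)
  have him : ∀ y ∈ U, J y (Z y).im = (Z y).re := fun y hy ↦ by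
    simpa using congrArg Cplx.im (hZJ y hy)
  have h1 (v) : J x (nab (fun y ↦ (Z y).re) x v) = -nab (fun y ↦ (Z y).im) x v := by
    rw [← hnab.parallel x _ hd.re, cov_congr hdre (mdifferentiableAt_neg_section hd.im)
      (Filter.eventually_of_mem (hU.mem_nhds hx) hre)]
    have := cov_fun_neg (cov := nab) hd.im
    exact congrArg (fun A ↦ A v) this
  have h2 (v) : J x (nab (fun y ↦ (Z y).im) x v) = nab (fun y ↦ (Z y).re) x v := by
    rw [← hnab.parallel x _ hd.im, cov_congr hdim hd.re
      (Filter.eventually_of_mem (hU.mem_nhds hx) him)]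
  ext <;> simp [covC, h1, h2] <;> abel

end CanonicalConnection

/-! ### Torsion components in a unitary frame and the Bianchi identity -/

section FrameSetting

open scoped Topology

variable {E : Type*} [NormedAddCommGroup E] [NormedSpace ℝ E] [FiniteDimensional ℝ E]
  {H : Type*} [TopologicalSpace H] {I : ModelWithCorners ℝ E H}
  {M : Type*} [TopologicalSpace M] [ChartedSpace H M] [IsManifold I ∞ M]
  {g : ContMDiffRiemannianMetric I ∞ E (fun x : M ↦ TangentSpace I x)}
  {J : Π x : M, TangentSpace I x →L[ℝ] TangentSpace I x}
  {D nab : CovariantDerivative I E (TangentSpace I : M → Type _)}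
  {n : ℕ} {e : Fin n → Π x : M, Cplx (TangentSpace I x)} {U : Set M}

/-- An almost Hermitian manifold with its Levi-Civita connection `D`, its canonical connection
`nab`, and a unitary frame `e` on an open set `U`. -/
structure FrameSetting
    (g : ContMDiffRiemannianMetric I ∞ E (fun x : M ↦ TangentSpace I x))
    (J : Π x : M, TangentSpace I x →L[ℝ] TangentSpace I x)
    (D nab : CovariantDerivative I E (TangentSpace I : M → Type _))
    (e : Fin n → Π x : M, Cplx (TangentSpace I x)) (U : Set M) : Prop where
  dim : Module.finrank ℝ E = 2 * n
  herm : IsAlmostHermitian g J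
  leviCivita : IsLeviCivita g D
  canonical : IsCanonicalConnection g J nab
  isOpen : IsOpen U
  frame : IsUnitaryFrameOn g J e U

namespace FrameSetting

variable {x : M}

lemma smooth (S : FrameSetting g J D nab e U) (i : Fin n) : SmoothOnC (e i) U :=
  ⟨S.frame.smooth_re i, S.frame.smooth_im i⟩

lemma mdiff (S : FrameSetting g J D nab e U) (hx : x ∈ U) (i : Fin n) : MDiffAtC (e i) x :=
  (S.smooth i).mdiffAtC S.isOpen hx

/-- The canonical covariant derivative of a frame field has type `(1,0)`. -/
lemma extendLin_nab (S : FrameSetting g J D nab e U) (hx : x ∈ U) (i : Fin n)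
    (w : Cplx (TangentSpace I x)) :
    Cplx.extendLin (J x) (covC nab (e i) x w) = Complex.I • covC nab (e i) x w :=
  S.canonical.extendLin_covC S.herm S.isOpen (S.smooth i)
    (fun y hy ↦ S.frame.type_one_zero y hy i) hx w

/-- Both vectors have type (1,0). This vanishing makes the relevant Levi-Civita coefficients depend
on torsion alone. -/
lemma pairing_nab (S : FrameSetting g J D nab e U) (hx : x ∈ U) (i j : Fin n)
    (w : Cplx (TangentSpace I x)) :
    Cplx.pairing (g.inner x) (covC nab (e i) x w) (e j x) = 0 :=
  Cplx.pairing_eq_zero (S.herm.orthogonal x) (S.extendLin_nab hx i w)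
    (S.frame.type_one_zero x hx j)

lemma pairing_nab_nab (S : FrameSetting g J D nab e U) (hx : x ∈ U) (i j : Fin n)
    (v w : Cplx (TangentSpace I x)) :
    Cplx.pairing (g.inner x) (covC nab (e i) x v) (covC nab (e j) x w) = 0 :=
  Cplx.pairing_eq_zero (S.herm.orthogonal x) (S.extendLin_nab hx i v) (S.extendLin_nab hx j w)

/-- Expansion of the metric in the frame. -/
lemma pairing_eq_sum (S : FrameSetting g J D nab e U) (hx : x ∈ U)
    (v w : Cplx (TangentSpace I x)) :
    Cplx.pairing (g.inner x) v w =
      ∑ m, (Cplx.pairing (g.inner x) v (e m x).conj * Cplx.pairing (g.inner x) w (e m x)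
        + Cplx.pairing (g.inner x) v (e m x) * Cplx.pairing (g.inner x) w (e m x).conj) := by
  conv_lhs => rw [S.frame.eq_sum_comp S.dim S.herm hx w]
  simp only [Cplx.pairing_eq, map_add, map_sum, map_smul, smul_eq_mul, holComp, antiComp,
    Finset.sum_add_distrib]
  rw [add_comm]
  congr 1 <;> exact Finset.sum_congr rfl fun m _ ↦ mul_comm _ _

lemma torsionForm_conj_right (S : FrameSetting g J D nab e U) (hx : x ∈ U) (a b : Fin n)
    (w : Cplx (TangentSpace I x)) : torsionForm g nab x (e a x) (e b x).conj w = 0 := by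
  rw [torsionForm_apply, torsionC, S.canonical.torsion_one_one x _ _
    (S.frame.type_one_zero x hx a) (S.frame.type_one_zero x hx b), Cplx.pairing_eq, map_zero,
    LinearMap.zero_apply]

lemma torsionForm_conj_left (S : FrameSetting g J D nab e U) (hx : x ∈ U) (a b : Fin n)
    (w : Cplx (TangentSpace I x)) : torsionForm g nab x (e a x).conj (e b x) w = 0 := by
  rw [torsionForm_antisymm, S.torsionForm_conj_right hx, neg_zero]

/-- Only the `(1,0)`-part of a vector contributes to its torsion with a frame vector. -/
lemma torsionForm_eq_sum (S : FrameSetting g J D nab e U) (hx : x ∈ U) (b : Fin n)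
    (v w : Cplx (TangentSpace I x)) :
    torsionForm g nab x v (e b x) w =
      ∑ m, Cplx.pairing (g.inner x) v (e m x).conj * torsionForm g nab x (e m x) (e b x) w := by
  conv_lhs => rw [S.frame.eq_sum_comp S.dim S.herm hx v]
  simp only [map_add, map_sum, map_smul, smul_eq_mul, LinearMap.add_apply, LinearMap.sum_apply,
    LinearMap.smul_apply, S.torsionForm_conj_left hx, mul_zero, Finset.sum_const_zero, add_zero,
    holComp]

/-- The ∇-part of the difference formula vanishes by `pairing_nab`, so the Levi-Civita coefficients
are torsion components, with no connection terms left over. -/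
lemma two_mul_pairing_levi (S : FrameSetting g J D nab e U) (hx : x ∈ U) (i j : Fin n)
    (v : Cplx (TangentSpace I x)) :
    2 * Cplx.pairing (g.inner x) (covC D (e i) x v) (e j x) =
      torsionForm g nab x (e i x) (e j x) v - torsionForm g nab x v (e i x) (e j x)
        - torsionForm g nab x (e j x) v (e i x) := by
  have h := S.leviCivita.two_mul_pairing_sub S.canonical.metric (S.mdiff hx i) v (e j x)
  have h0 := S.pairing_nab hx i j v
  simp only [Cplx.pairing_eq, map_sub, LinearMap.sub_apply] at h h0 ⊢
  rw [h0, sub_zero] at h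
  exact h

variable [T2Space M]

lemma smooth_torsion (S : FrameSetting g J D nab e U) (k l : Fin n) :
    SmoothOnC (fun y ↦ torsionC nab y (e k y) (e l y)) U :=
  ((((S.smooth k).covC S.canonical.smooth S.isOpen (S.smooth l)).sub
    ((S.smooth l).covC S.canonical.smooth S.isOpen (S.smooth k))).sub
    ((S.smooth k).bracketC S.isOpen (S.smooth l))).congr fun _ hy ↦
      torsionC_eq (S.mdiff hy k) (S.mdiff hy l)

lemma funMDiff_torsionAnti (S : FrameSetting g J D nab e U) (hx : x ∈ U) (k l j : Fin n) :
    FunMDiffAtC I (fun y ↦ torsionAnti g nab e y k l j) x :=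
  funMDiffAtC_pairing g ((S.smooth_torsion k l).mdiffAtC S.isOpen hx) (S.mdiff hx j)

/-- The components of the covariant derivative of the torsion in terms of the derivatives of the
components. -/
lemma covTorsionAnti_eq (S : FrameSetting g J D nab e U) (hx : x ∈ U) (k l i j : Fin n) :
    covTorsionAnti g nab e x k l i j =
      diffC (fun y ↦ torsionAnti g nab e y k l j) x (e i x)
        - torsionForm g nab x (covC nab (e k) x (e i x)) (e l x) (e j x)
        - torsionForm g nab x (e k x) (covC nab (e l) x (e i x)) (e j x)
        - torsionForm g nab x (e k x) (e l x) (covC nab (e j) x (e i x)) := by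
  have h := S.canonical.metric.diffC_pairing
    ((S.smooth_torsion k l).mdiffAtC S.isOpen hx) (S.mdiff hx j) (e i x)
  simp only [covTorsionAnti, antiComp, covTorsionC, torsionForm_apply]
  change diffC (fun y ↦ torsionAnti g nab e y k l j) x (e i x) = _ at h
  rw [h]
  simp only [Cplx.pairing_eq, map_sub, LinearMap.sub_apply]
  ring

/-- The `(0,1)`-part of the covariant derivative of the torsion by means of brackets. -/
lemma covTorsionAnti_eq_bracket (S : FrameSetting g J D nab e U) (hx : x ∈ U) (l i k j : Fin n) :
    covTorsionAnti g nab e x l i k j =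
      -Cplx.pairing (g.inner x) (bracketC (e k) (bracketC (e l) (e i)) x) (e j x)
        - torsionForm g nab x (e k x) (covC nab (e i) x (e l x)) (e j x)
        + torsionForm g nab x (e k x) (covC nab (e l) x (e i x)) (e j x)
        + torsionForm g nab x (e k x) (torsionC nab x (e l x) (e i x)) (e j x)
        - torsionForm g nab x (covC nab (e l) x (e k x)) (e i x) (e j x)
        - torsionForm g nab x (e l x) (covC nab (e i) x (e k x)) (e j x) := by
  have hU := S.isOpen
  have sb : SmoothOnC (bracketC (e l) (e i)) U := (S.smooth l).bracketC hU (S.smooth i)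
  have sN (a b : Fin n) : SmoothOnC (fun y ↦ covC nab (e b) y (e a y)) U :=
    (S.smooth a).covC S.canonical.smooth hU (S.smooth b)
  -- Second covariant derivatives of the frame remain of type (1,0) and disappear on pairing with
  -- e_j; hence there is no curvature term.
  have hN (a b : Fin n) : Cplx.pairing (g.inner x)
      (covC nab (fun y ↦ covC nab (e b) y (e a y)) x (e k x)) (e j x) = 0 :=
    Cplx.pairing_eq_zero (S.herm.orthogonal x)
      (S.canonical.extendLin_covC S.herm hU (sN a b) (fun y hy ↦ S.extendLin_nab hy b _) hx _)
      (S.frame.type_one_zero x hx j)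
  -- Replaces ∇_{e_k}[e_l, e_i] by [e_k, [e_l, e_i]] + ∇_{[e_l, e_i]} e_k + τ(e_k, [e_l, e_i]); the
  -- middle term pairs to zero with e_j by `h0`, and `hli` expands the last.
  have hb := torsionC_eq (cov := nab) (S.mdiff hx k) (sb.mdiffAtC hU hx)
  have hli := torsionC_eq (cov := nab) (S.mdiff hx l) (S.mdiff hx i)
  have hc : covC nab (fun y ↦ torsionC nab y (e l y) (e i y)) x (e k x) =
      covC nab (fun y ↦ covC nab (e i) y (e l y)) x (e k x)
        - covC nab (fun y ↦ covC nab (e l) y (e i y)) x (e k x)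
        - covC nab (bracketC (e l) (e i)) x (e k x) := by
    rw [← covC_sub ((sN l i).mdiffAtC hU hx) ((sN i l).mdiffAtC hU hx),
      ← covC_sub (((sN l i).sub (sN i l)).mdiffAtC hU hx) (sb.mdiffAtC hU hx)]
    exact covC_congr ((S.smooth_torsion l i).mdiffAtC hU hx)
      ((((sN l i).sub (sN i l)).sub sb).mdiffAtC hU hx)
      (Filter.eventually_of_mem (hU.mem_nhds hx) fun y hy ↦
        torsionC_eq (S.mdiff hy l) (S.mdiff hy i)) _
  have h0 := S.pairing_nab hx k j (bracketC (e l) (e i) x)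
  have hb' := congrArg (fun u ↦ Cplx.pairingₗ (g.inner x) u (e j x)) hb
  have hli' := congrArg (fun u ↦ torsionForm g nab x (e k x) u (e j x)) hli
  have h1 := hN l i
  have h2 := hN i l
  simp only [covTorsionAnti, antiComp, covTorsionC, hc]
  simp only [torsionForm_apply, Cplx.pairing_eq, map_sub, LinearMap.sub_apply]
    at hb' hli' h0 h1 h2 ⊢
  linear_combination h1 - h2 + hb' - h0 - hli'

/-- The `(0,1)`-part of the first Bianchi identity for the canonical connection. -/
lemma bianchi (S : FrameSetting g J D nab e U) (hx : x ∈ U) (k l i j : Fin n) :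
    covTorsionAnti g nab e x k l i j + covTorsionAnti g nab e x l i k j
      + covTorsionAnti g nab e x i k l j =
      -∑ m, (torsionHol g nab e x k l m * torsionAnti g nab e x m i j
        + torsionHol g nab e x l i m * torsionAnti g nab e x m k j
        + torsionHol g nab e x i k m * torsionAnti g nab e x m l j) := by
  have hj := congrArg (fun u ↦ Cplx.pairingₗ (g.inner x) u (e j x))
    (bracketC_jacobi S.isOpen hx (S.smooth k) (S.smooth l) (S.smooth i))
  have ht (a b c : Fin n) :
      torsionForm g nab x (e c x) (torsionC nab x (e a x) (e b x)) (e j x) =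
        -∑ m, torsionHol g nab e x a b m * torsionAnti g nab e x m c j := by
    rw [torsionForm_antisymm, S.torsionForm_eq_sum hx]
    rfl
  have ha (a b c : Fin n) := torsionForm_antisymm (g := g) (cov := nab)
    (covC nab (e a) x (e b x)) (e c x) (e j x)
  rw [S.covTorsionAnti_eq_bracket hx, S.covTorsionAnti_eq_bracket hx,
    S.covTorsionAnti_eq_bracket hx, ht, ht, ht]
  simp only [Finset.sum_add_distrib]
  simp only [Cplx.pairing_eq, map_add, map_zero, LinearMap.add_apply, LinearMap.zero_apply] at hj ⊢
  -- In the cyclic sum the double brackets cancel by Jacobi and the terms with ∇e by antisymmetry of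
  -- τ; only τ(·, τ(·, ·)) survives.
  linear_combination -hj - ha k i l - ha l k i - ha i l k

end FrameSetting

end FrameSetting

/-! ### The curvature formula -/

section CurvatureFormula

open scoped Topology

variable {E : Type*} [NormedAddCommGroup E] [NormedSpace ℝ E] [FiniteDimensional ℝ E]
  {H : Type*} [TopologicalSpace H] {I : ModelWithCorners ℝ E H}
  {M : Type*} [TopologicalSpace M] [ChartedSpace H M] [IsManifold I ∞ M]
  {g : ContMDiffRiemannianMetric I ∞ E (fun x : M ↦ TangentSpace I x)}
  {J : Π x : M, TangentSpace I x →L[ℝ] TangentSpace I x}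
  {D nab : CovariantDerivative I E (TangentSpace I : M → Type _)}
  {n : ℕ} {e : Fin n → Π x : M, Cplx (TangentSpace I x)} {U : Set M} {x : M}

lemma torsionHol_antisymm (a b c : Fin n) :
    torsionHol g nab e x a b c = -torsionHol g nab e x b a c :=
  torsionForm_antisymm (e a x) (e b x) (e c x).conj

lemma torsionAnti_antisymm (a b c : Fin n) :
    torsionAnti g nab e x a b c = -torsionAnti g nab e x b a c :=
  torsionForm_antisymm (e a x) (e b x) (e c x)

namespace FrameSetting

/-- Scalar products of the covariant derivatives of frame fields for the Levi-Civita connection. -/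
lemma four_mul_pairing_levi_levi (S : FrameSetting g J D nab e U) (hx : x ∈ U) (l i k j : Fin n) :
    4 * Cplx.pairing (g.inner x) (covC D (e i) x (e l x)) (covC D (e j) x (e k x)) =
      2 * (torsionForm g nab x (e i x) (covC nab (e j) x (e k x)) (e l x)
        - torsionForm g nab x (e l x) (e i x) (covC nab (e j) x (e k x))
        - torsionForm g nab x (covC nab (e j) x (e k x)) (e l x) (e i x))
      + 2 * (torsionForm g nab x (e j x) (covC nab (e i) x (e l x)) (e k x)
        - torsionForm g nab x (e k x) (e j x) (covC nab (e i) x (e l x))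
        - torsionForm g nab x (covC nab (e i) x (e l x)) (e k x) (e j x))
      - ∑ m, (torsionHol g nab e x l i m * (torsionAnti g nab e x j m k
          - torsionAnti g nab e x k j m - torsionAnti g nab e x m k j)
        + torsionHol g nab e x k j m * (torsionAnti g nab e x i m l
          - torsionAnti g nab e x l i m - torsionAnti g nab e x m l i)) := by
  have hk (a b : Fin n) (w) := S.leviCivita.two_mul_pairing_sub S.canonical.metric
    (S.mdiff hx b) (e a x) w
  -- Against a conjugate frame vector, two of the three torsion terms have mixed type and vanish.
  have hconj (a b m : Fin n) : 2 * Cplx.pairing (g.inner x)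
      (covC D (e b) x (e a x) - covC nab (e b) x (e a x)) (e m x).conj =
      -torsionHol g nab e x a b m := by
    rw [hk, S.torsionForm_conj_right hx, S.torsionForm_conj_left hx, zero_sub, sub_zero]
    rfl
  have hfr (a b m : Fin n) : 2 * Cplx.pairing (g.inner x)
      (covC D (e b) x (e a x) - covC nab (e b) x (e a x)) (e m x) =
      torsionAnti g nab e x b m a - torsionAnti g nab e x a b m - torsionAnti g nab e x m a b :=
    hk a b _
  -- With A = D − ∇, the product ⟨A e_i, A e_j⟩ is expanded in the unitary frame: each summand pairs
  -- one conjugate coefficient (`hconj`) with one frame coefficient (`hfr`).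
  have hsum : 4 * Cplx.pairing (g.inner x) (covC D (e i) x (e l x) - covC nab (e i) x (e l x))
      (covC D (e j) x (e k x) - covC nab (e j) x (e k x)) =
      -∑ m, (torsionHol g nab e x l i m * (torsionAnti g nab e x j m k
          - torsionAnti g nab e x k j m - torsionAnti g nab e x m k j)
        + torsionHol g nab e x k j m * (torsionAnti g nab e x i m l
          - torsionAnti g nab e x l i m - torsionAnti g nab e x m l i)) := by
    rw [S.pairing_eq_sum hx, Finset.mul_sum, ← Finset.sum_neg_distrib]
    refine Finset.sum_congr rfl fun m _ ↦ ?_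
    rw [← hfr k j m, ← hfr l i m, ← neg_neg (torsionHol g nab e x l i m), ← hconj l i m,
      ← neg_neg (torsionHol g nab e x k j m), ← hconj k j m]
    ring
  have h1 := hk l i (covC nab (e j) x (e k x))
  have h2 := hk k j (covC nab (e i) x (e l x))
  have h0 := S.pairing_nab_nab hx i j (e l x) (e k x)
  have hc := Cplx.pairing_comm (g.symm x) (covC nab (e i) x (e l x)) (covC nab (e j) x (e k x))
  have hc' := Cplx.pairing_comm (g.symm x) (covC nab (e i) x (e l x)) (covC D (e j) x (e k x))
  -- ⟨D, D⟩ = ⟨A, A⟩ + ⟨A, ∇⟩ + ⟨∇, A⟩ + ⟨∇, ∇⟩, and the last term is zero by type.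
  rw [sub_eq_add_neg _ (∑ m, _), ← hsum, ← h1, ← h2]
  simp only [Cplx.pairing_eq, map_sub, LinearMap.sub_apply] at h0 hc hc' ⊢
  linear_combination 4 * hc' - 4 * hc + 4 * h0

/-- The bracket term of the curvature. -/
lemma two_mul_pairing_levi_bracket (S : FrameSetting g J D nab e U) (hx : x ∈ U)
    (i j k l : Fin n) :
    2 * Cplx.pairing (g.inner x) (covC D (e i) x (bracketC (e k) (e l) x)) (e j x) =
      torsionForm g nab x (e i x) (e j x) (covC nab (e l) x (e k x))
      - torsionForm g nab x (e i x) (e j x) (covC nab (e k) x (e l x))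
      - torsionForm g nab x (covC nab (e l) x (e k x)) (e i x) (e j x)
      + torsionForm g nab x (covC nab (e k) x (e l x)) (e i x) (e j x)
      - torsionForm g nab x (e j x) (covC nab (e l) x (e k x)) (e i x)
      + torsionForm g nab x (e j x) (covC nab (e k) x (e l x)) (e i x)
      - ∑ m, (torsionHol g nab e x i j m * torsionAnti g nab e x k l m
        + torsionAnti g nab e x i j m * torsionHol g nab e x k l m)
      + ∑ m, torsionHol g nab e x k l m * torsionAnti g nab e x m i j
      - ∑ m, torsionHol g nab e x k l m * torsionAnti g nab e x m j i := by
  have hb : bracketC (e k) (e l) x = covC nab (e l) x (e k x) - covC nab (e k) x (e l x)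
      - torsionC nab x (e k x) (e l x) := by
    rw [torsionC_eq (S.mdiff hx k) (S.mdiff hx l)]; abel
  have h1 : torsionForm g nab x (e i x) (e j x) (torsionC nab x (e k x) (e l x)) =
      ∑ m, (torsionHol g nab e x i j m * torsionAnti g nab e x k l m
        + torsionAnti g nab e x i j m * torsionHol g nab e x k l m) :=
    S.pairing_eq_sum hx _ _
  have h2 (a b : Fin n) : torsionForm g nab x (torsionC nab x (e k x) (e l x)) (e a x) (e b x) =
      ∑ m, torsionHol g nab e x k l m * torsionAnti g nab e x m a b :=
    S.torsionForm_eq_sum hx _ _ _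
  rw [S.two_mul_pairing_levi hx, hb, ← h1, ← h2, ← h2,
    torsionForm_antisymm (torsionC nab x (e k x) (e l x)) (e j x)]
  simp only [map_sub, LinearMap.sub_apply]
  ring

variable [T2Space M]

lemma covTorsionAnti_antisymm (S : FrameSetting g J D nab e U) (hx : x ∈ U) (k l i j : Fin n) :
    covTorsionAnti g nab e x k l i j = -covTorsionAnti g nab e x l k i j := by
  have h : diffC (fun y ↦ torsionAnti g nab e y k l j) x (e i x) =
      -diffC (fun y ↦ torsionAnti g nab e y l k j) x (e i x) := by
    rw [← diffC_neg]
    congr 1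
    exact funext fun y ↦ torsionAnti_antisymm k l j
  rw [S.covTorsionAnti_eq hx, S.covTorsionAnti_eq hx, h,
    torsionForm_antisymm (covC nab (e k) x (e i x)), torsionForm_antisymm (e k x),
    torsionForm_antisymm (e k x)]
  ring

/-- The derivatives of the components of the Levi-Civita connection. -/
lemma two_mul_diffC_pairing_levi (S : FrameSetting g J D nab e U) (hx : x ∈ U) (a i j : Fin n)
    (w : Cplx (TangentSpace I x)) :
    2 * diffC (fun y ↦ Cplx.pairing (g.inner y) (covC D (e i) y (e a y)) (e j y)) x w =
      diffC (fun y ↦ torsionAnti g nab e y i j a) x w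
        - diffC (fun y ↦ torsionAnti g nab e y a i j) x w
        - diffC (fun y ↦ torsionAnti g nab e y j a i) x w := by
  have hd : FunMDiffAtC I
      (fun y ↦ Cplx.pairing (g.inner y) (covC D (e i) y (e a y)) (e j y)) x :=
    funMDiffAtC_pairing g (((S.smooth a).covC S.leviCivita.smooth S.isOpen
      (S.smooth i)).mdiffAtC S.isOpen hx) (S.mdiff hx j)
  have hs := S.funMDiff_torsionAnti hx
  rw [two_mul, ← diffC_add hd hd, ← diffC_sub (hs i j a) (hs a i j),
    ← diffC_sub ((hs i j a).sub (hs a i j)) (hs j a i)]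
  -- The coefficient identity holds on all of `U`, so it may be differentiated at `x`.
  refine diffC_congr (Filter.eventually_of_mem (S.isOpen.mem_nhds hx) fun y hy ↦ ?_) w
  exact (two_mul _).symm.trans (S.two_mul_pairing_levi hy i j (e a y))

/-- The Levi-Civita curvature by means of the metric. -/
lemma curvComp_eq (S : FrameSetting g J D nab e U) (hx : x ∈ U) (i j k l : Fin n) :
    curvComp g D e x i j k l =
      diffC (fun y ↦ Cplx.pairing (g.inner y) (covC D (e i) y (e l y)) (e j y)) x (e k x)
      - diffC (fun y ↦ Cplx.pairing (g.inner y) (covC D (e i) y (e k y)) (e j y)) x (e l x)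
      - Cplx.pairing (g.inner x) (covC D (e i) x (e l x)) (covC D (e j) x (e k x))
      + Cplx.pairing (g.inner x) (covC D (e i) x (e k x)) (covC D (e j) x (e l x))
      - Cplx.pairing (g.inner x) (covC D (e i) x (bracketC (e k) (e l) x)) (e j x) := by
  have h (a b : Fin n) := S.leviCivita.metric.diffC_pairing
    (((S.smooth a).covC S.leviCivita.smooth S.isOpen (S.smooth i)).mdiffAtC S.isOpen hx)
    (S.mdiff hx j) (e b x)
  rw [h, h]
  simp only [curvComp, curvatureC, Cplx.pairing_eq, map_sub, LinearMap.sub_apply]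
  ring

/-- The `(2,0)`-part of the Levi-Civita curvature in terms of the torsion of the canonical
connection. -/
theorem curvComp_eq_torsion (S : FrameSetting g J D nab e U) (hx : x ∈ U) (i j k l : Fin n) :
    let t := torsionHol g nab e x
    let s := torsionAnti g nab e x
    let ds := covTorsionAnti g nab e x
    curvComp g D e x i j k l =
      1 / 2 * (ds k l i j - ds k l j i) + 1 / 2 * (ds i j k l - ds i j l k)
        + 1 / 2 * ∑ m, (t i j m * s k l m + s i j m * t k l m)
        + 1 / 4 * ∑ m, t i k m * (s j l m - s l m j - s m j l)
        + 1 / 4 * ∑ m, t j l m * (s i k m - s k m i - s m i k)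
        - 1 / 4 * ∑ m, t i l m * (s j k m - s k m j - s m j k)
        - 1 / 4 * ∑ m, t j k m * (s i l m - s l m i - s m i l) := by
  intro t s ds
  have tA (a b c) : t a b c = -t b a c := torsionHol_antisymm a b c
  have sA (a b c) : s a b c = -s b a c := torsionAnti_antisymm a b c
  have hR := S.curvComp_eq hx i j k l
  have hbr := S.two_mul_pairing_levi_bracket hx i j k l
  have hLK := S.four_mul_pairing_levi_levi hx l i k j
  have hKL := S.four_mul_pairing_levi_levi hx k i l j
  have hdl := S.two_mul_diffC_pairing_levi hx l i j (e k x)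
  have hdk := S.two_mul_diffC_pairing_levi hx k i j (e l x)
  have hds := S.covTorsionAnti_eq hx
  have dsA := S.covTorsionAnti_antisymm hx
  have B1 := S.bianchi hx k l i j
  have B2 := S.bianchi hx k l j i
  have TA := torsionForm_antisymm (g := g) (cov := nab) (x := x)
  -- All quadratic terms: from the products ⟨D, D⟩, from the bracket, and from the two Bianchi
  -- identities. They agree summand by summand up to antisymmetry.
  have hsum :
      (∑ m, (t l i m * (s j m k - s k j m - s m k j) + t k j m * (s i m l - s l i m - s m l i)))
      - (∑ m, (t k i m * (s j m l - s l j m - s m l j) + t l j m * (s i m k - s k i m - s m k i)))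
      - 2 * (∑ m, t k l m * s m i j) + 2 * (∑ m, t k l m * s m j i)
      + 2 * (∑ m, (t k l m * s m i j + t l i m * s m k j + t i k m * s m l j))
      - 2 * (∑ m, (t k l m * s m j i + t l j m * s m k i + t j k m * s m l i)) =
      ∑ m, t i k m * (s j l m - s l m j - s m j l)
        + ∑ m, t j l m * (s i k m - s k m i - s m i k)
        - ∑ m, t i l m * (s j k m - s k m j - s m j k)
        - ∑ m, t j k m * (s i l m - s l m i - s m i l) := by
    simp only [Finset.mul_sum, ← Finset.sum_add_distrib, ← Finset.sum_sub_distrib]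
    refine Finset.sum_congr rfl fun m _ ↦ ?_
    rw [tA l i, tA k j, tA k i, tA l j, sA j m, sA i m, sA k j, sA l i, sA l j, sA k i, sA j m l,
      sA i m k, sA l m j, sA k m i, sA k m j, sA l m i]
    ring
  -- `hds` turns derivatives into covariant ones. `B1` trades τ_{li;k}^{j̄} + τ_{ik;l}^{j̄} for
  -- −τ_{kl;i}^{j̄}, and `B2` does the same with i and j exchanged. The `TA` terms align the
  -- leftover ∇e terms so that they cancel.
  linear_combination hR + 1 / 2 * hdl - 1 / 2 * hdk - 1 / 4 * hLK + 1 / 4 * hKL - 1 / 2 * hbr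
    - 1 / 2 * (hds i j k l - hds l i k j - hds j l k i)
    + 1 / 2 * (hds i j l k - hds k i l j - hds j k l i)
    - 1 / 2 * B1 + 1 / 2 * B2 + 1 / 2 * dsA k i l j - 1 / 2 * dsA j l k i + 1 / 4 * hsum
    + 1 / 2 * TA (covC nab (e i) x (e k x)) (e j x) (e l x)
    - 1 / 2 * TA (e l x) (e j x) (covC nab (e i) x (e k x))
    - 1 / 2 * TA (covC nab (e i) x (e k x)) (e l x) (e j x)
    - 1 / 2 * TA (covC nab (e i) x (e l x)) (e j x) (e k x)
    + 1 / 2 * TA (e k x) (e j x) (covC nab (e i) x (e l x))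
    + 1 / 2 * TA (covC nab (e i) x (e l x)) (e k x) (e j x)

end FrameSetting

end CurvatureFormula

/-! ### Hermitian and nearly Kähler manifolds -/

section SpecialCases

open VectorField
open scoped Topology

variable {E : Type*} [NormedAddCommGroup E] [NormedSpace ℝ E]
  {H : Type*} [TopologicalSpace H] {I : ModelWithCorners ℝ E H}
  {M : Type*} [TopologicalSpace M] [ChartedSpace H M] [IsManifold I ∞ M]
  {g : ContMDiffRiemannianMetric I ∞ E (fun x : M ↦ TangentSpace I x)}
  {J : Π x : M, TangentSpace I x →L[ℝ] TangentSpace I x}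
  {D nab : CovariantDerivative I E (TangentSpace I : M → Type _)}

lemma covC_const_smul {cov : CovariantDerivative I E (TangentSpace I : M → Type _)} {x : M}
    {Y : Π x : M, Cplx (TangentSpace I x)} (hY : MDiffAtC Y x) (c : ℂ)
    (w : Cplx (TangentSpace I x)) :
    covC cov (fun y ↦ c • Y y) x w = c • covC cov Y x w := by
  have hs {σ : Π x : M, TangentSpace I x} (hσ : MDiffAt (T% σ) x) (a : ℝ) :
      MDiffAt (T% (fun y ↦ a • σ y)) x := hσ.smul_const_section
  have hc {σ : Π x : M, TangentSpace I x} (hσ : MDiffAt (T% σ) x) (a : ℝ) :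
      cov (fun y ↦ a • σ y) x = a • cov σ x :=
    cov.isCovariantDerivativeOnUniv.smul_const a hσ
  ext
  · simp only [covC, Cplx.smul_re, Cplx.smul_im, cov_fun_sub (hs hY.re c.re) (hs hY.im c.im),
      cov_fun_add (hs hY.im c.re) (hs hY.re c.im), hc hY.re, hc hY.im]
    simp
    module
  · simp only [covC, Cplx.smul_re, Cplx.smul_im, cov_fun_sub (hs hY.re c.re) (hs hY.im c.im),
      cov_fun_add (hs hY.im c.re) (hs hY.re c.im), hc hY.re, hc hY.im]
    simp
    module

/-- The polarized nearly Kähler condition for complex vector fields. -/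
lemma IsNearlyKahler.covC_add (hK : IsNearlyKahler J D) (hJ : IsAlmostHermitian g J)
    {U : Set M} (hU : IsOpen U) {X Y : Π x : M, Cplx (TangentSpace I x)}
    (hX : SmoothOnC X U) (hY : SmoothOnC Y U) {x : M} (hx : x ∈ U) :
    covC D (fun y ↦ Cplx.extendLin (J y) (Y y)) x (X x) - Cplx.extendLin (J x) (covC D Y x (X x))
      + covC D (fun y ↦ Cplx.extendLin (J y) (X y)) x (Y x)
      - Cplx.extendLin (J x) (covC D X x (Y x)) = 0 := by
  have hn := hU.mem_nhds hx
  have key {u v : Π x : M, TangentSpace I x} (hu : CMDiff[U] ∞ (T% u))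
      (hv : CMDiff[U] ∞ (T% v)) :
      D (fun y ↦ J y (v y)) x (u x) - J x (D v x (u x)) + D (fun y ↦ J y (u y)) x (v x)
        - J x (D u x (v x)) = 0 := by
    have d {u : Π x : M, TangentSpace I x} (hu : CMDiff[U] ∞ (T% u)) :=
      mdifferentiableAt_of_contMDiffOn hU hx hu
    have dJ {u : Π x : M, TangentSpace I x} (hu : CMDiff[U] ∞ (T% u)) :=
      mdifferentiableAt_of_contMDiffOn hU hx (contMDiffOn_clm_apply hJ.smooth.contMDiffOn hu)
    -- Polarization: the condition for u, v and u + v.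
    have h1 := hK x u ((hu x hx).contMDiffAt hn)
    have h2 := hK x v ((hv x hx).contMDiffAt hn)
    have h3 := hK x (fun y ↦ u y + v y)
      (((hu x hx).contMDiffAt hn).add_section ((hv x hx).contMDiffAt hn))
    simp only [map_add, cov_fun_add (dJ hu) (dJ hv), cov_fun_add (d hu) (d hv),
      add_apply] at h3
    linear_combination (norm := abel) h3 - h1 - h2
  ext
  · simp only [Cplx.sub_re, Cplx.add_re, Cplx.zero_re, covC, Cplx.extendLin_re, Cplx.extendLin_im,
      map_sub]
    linear_combination (norm := abel) key hX.re hY.re - key hX.im hY.im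
  · simp only [Cplx.sub_im, Cplx.add_im, Cplx.zero_im, covC, Cplx.extendLin_re, Cplx.extendLin_im,
      map_add]
    linear_combination (norm := abel) key hX.re hY.im + key hX.im hY.re

/-- Needed for c = i (frame fields) and c = −i (their conjugates). The eigenvalue equation holds
only on `U`, so locality of the connection enters. -/
lemma covC_extendLin {cov : CovariantDerivative I E (TangentSpace I : M → Type _)}
    (hJ : IsAlmostHermitian g J) {U : Set M} (hU : IsOpen U)
    {Y : Π x : M, Cplx (TangentSpace I x)} (hY : SmoothOnC Y U) {c : ℂ}
    (hYJ : ∀ x ∈ U, Cplx.extendLin (J x) (Y x) = c • Y x) {x : M} (hx : x ∈ U)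
    (w : Cplx (TangentSpace I x)) :
    covC cov (fun y ↦ Cplx.extendLin (J y) (Y y)) x w = c • covC cov Y x w := by
  have hd := hY.mdiffAtC hU hx
  have hs : MDiffAtC (fun y ↦ c • Y y) x :=
    ⟨mdifferentiableAt_sub_section hd.re.smul_const_section hd.im.smul_const_section,
      mdifferentiableAt_add_section hd.im.smul_const_section hd.re.smul_const_section⟩
  have hJY : SmoothOnC (fun y ↦ Cplx.extendLin (J y) (Y y)) U :=
    ⟨contMDiffOn_clm_apply hJ.smooth.contMDiffOn hY.re,
      contMDiffOn_clm_apply hJ.smooth.contMDiffOn hY.im⟩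
  rw [covC_congr (hJY.mdiffAtC hU hx) hs (Filter.eventually_of_mem (hU.mem_nhds hx) hYJ),
    covC_const_smul hd]

variable [FiniteDimensional ℝ E]

lemma mlieBracket_fun_neg_left {x : M} {u v : Π x : M, TangentSpace I x}
    (hu : MDiffAt (T% u) x) :
    mlieBracket I (fun y ↦ -u y) v x = -mlieBracket I u v x := by
  have := mlieBracket_const_smul_left (c := (-1 : ℝ)) (W := v) hu
  rw [neg_one_smul, neg_one_smul] at this
  exact this

lemma mlieBracket_fun_neg_right {x : M} {u v : Π x : M, TangentSpace I x}
    (hv : MDiffAt (T% v) x) :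
    mlieBracket I u (fun y ↦ -v y) x = -mlieBracket I u v x := by
  rw [mlieBracket_swap_apply, mlieBracket_fun_neg_left hv, mlieBracket_swap_apply (V := u)]

/-- On a Hermitian manifold the bracket of vector fields of type `(1,0)` has type `(1,0)`. -/
lemma IsIntegrable.extendLin_bracketC (hN : IsIntegrable J) (hJ : IsAlmostHermitian g J)
    {U : Set M} (hU : IsOpen U) {X Y : Π x : M, Cplx (TangentSpace I x)}
    (hX : SmoothOnC X U) (hY : SmoothOnC Y U)
    (hXJ : ∀ x ∈ U, Cplx.extendLin (J x) (X x) = Complex.I • X x)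
    (hYJ : ∀ x ∈ U, Cplx.extendLin (J x) (Y x) = Complex.I • Y x) {x : M} (hx : x ∈ U) :
    Cplx.extendLin (J x) (bracketC X Y x) = Complex.I • bracketC X Y x := by
  have hn := hU.mem_nhds hx
  have hXd := hX.mdiffAtC hU hx
  have hYd := hY.mdiffAtC hU hx
  have hXre : ∀ y ∈ U, J y (X y).re = -(X y).im := fun y hy ↦ by
    simpa using congrArg Cplx.re (hXJ y hy)
  have hYre : ∀ y ∈ U, J y (Y y).re = -(Y y).im := fun y hy ↦ by
    simpa using congrArg Cplx.re (hYJ y hy)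
  -- The real parts suffice: J Re = −Im turns N(Re X, Re Y) = 0 into J Im[X, Y] = Re[X, Y], and
  -- applying J gives the other half.
  have h := hN x _ _ ((hX.re x hx).contMDiffAt hn) ((hY.re x hx).contMDiffAt hn)
  have hb1 : mlieBracket I (fun y ↦ J y (X y).re) (fun y ↦ J y (Y y).re) x =
      mlieBracket I (fun y ↦ -(X y).im) (fun y ↦ -(Y y).im) x :=
    Filter.EventuallyEq.mlieBracket_vectorField_eq (Filter.eventually_of_mem hn hXre)
      (Filter.eventually_of_mem hn hYre)
  have hb2 : mlieBracket I (fun y ↦ J y (X y).re) (fun y ↦ (Y y).re) x =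
      mlieBracket I (fun y ↦ -(X y).im) (fun y ↦ (Y y).re) x :=
    Filter.EventuallyEq.mlieBracket_vectorField_eq (Filter.eventually_of_mem hn hXre) .rfl
  have hb3 : mlieBracket I (fun y ↦ (X y).re) (fun y ↦ J y (Y y).re) x =
      mlieBracket I (fun y ↦ (X y).re) (fun y ↦ -(Y y).im) x :=
    Filter.EventuallyEq.mlieBracket_vectorField_eq .rfl (Filter.eventually_of_mem hn hYre)
  rw [hb1, hb2, hb3,
    mlieBracket_fun_neg_left hXd.im, mlieBracket_fun_neg_right hYd.im,
    mlieBracket_fun_neg_left hXd.im, mlieBracket_fun_neg_right hYd.im] at h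
  have him : J x (bracketC X Y x).im = (bracketC X Y x).re := by
    simp only [bracketC, map_add]
    simp only [map_neg] at h
    rw [← sub_eq_zero, ← h]
    abel
  have hre : J x (bracketC X Y x).re = -(bracketC X Y x).im := by
    rw [← him, hJ.sq]
  ext <;> simp [him, hre]

variable {n : ℕ} {e : Fin n → Π x : M, Cplx (TangentSpace I x)} {U : Set M} {x : M}

namespace FrameSetting

/-- All three terms of τ(e_k, e_l) = ∇_{e_k} e_l − ∇_{e_l} e_k − [e_k, e_l] have type (1,0), hence
pair to zero with e_m. -/
lemma torsionAnti_eq_zero (S : FrameSetting g J D nab e U) (hx : x ∈ U) (hN : IsIntegrable J)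
    (k l m : Fin n) : torsionAnti g nab e x k l m = 0 := by
  have hb := Cplx.pairing_eq_zero (S.herm.orthogonal x) (hN.extendLin_bracketC S.herm S.isOpen
    (S.smooth k) (S.smooth l) (fun y hy ↦ S.frame.type_one_zero y hy k)
    (fun y hy ↦ S.frame.type_one_zero y hy l) hx) (S.frame.type_one_zero x hx m)
  have h1 := S.pairing_nab hx l m (e k x)
  have h2 := S.pairing_nab hx k m (e l x)
  rw [torsionAnti, antiComp, torsionC_eq (S.mdiff hx k) (S.mdiff hx l)]
  simp only [Cplx.pairing_eq, map_sub, LinearMap.sub_apply] at hb h1 h2 ⊢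
  rw [hb, h1, h2]
  ring

/-- On a nearly Kähler manifold the components `τ_{kl}^{\bar m}` are totally antisymmetric. -/
lemma torsionAnti_swap (S : FrameSetting g J D nab e U) (hx : x ∈ U) (hK : IsNearlyKahler J D)
    (k l m : Fin n) : torsionAnti g nab e x k l m = -torsionAnti g nab e x m l k := by
  have h := hK.covC_add S.herm S.isOpen (S.smooth m) (S.smooth k) hx
  have ht (a : Fin n) := fun y hy ↦ S.frame.type_one_zero y hy a
  rw [covC_extendLin S.herm S.isOpen (S.smooth m) (ht m) hx,
    covC_extendLin S.herm S.isOpen (S.smooth k) (ht k) hx] at h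
  have hl := congrArg (fun u ↦ Cplx.pairingₗ (g.inner x) u (e l x)) h
  simp only [map_sub, map_add, map_smul, LinearMap.sub_apply, LinearMap.add_apply, map_zero,
    LinearMap.smul_apply, LinearMap.zero_apply, smul_eq_mul, ← Cplx.pairing_eq,
    Cplx.pairing_extendLin_left (S.herm.orthogonal x) _ (ht l x hx)] at hl
  have h1 : torsionAnti g nab e x k l m - torsionAnti g nab e x m k l
      - torsionAnti g nab e x l m k = _ := (S.two_mul_pairing_levi hx k l (e m x)).symm
  have h2 : torsionAnti g nab e x m l k - torsionAnti g nab e x k m l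
      - torsionAnti g nab e x l k m = _ := (S.two_mul_pairing_levi hx m l (e k x)).symm
  -- On pairing with e_l, −J contributes another factor i, so `hl` is 2i times this sum. Each
  -- summand is a torsion expression by `h1` and `h2`.
  have hz : Cplx.pairing (g.inner x) (covC D (e k) x (e m x)) (e l x)
      + Cplx.pairing (g.inner x) (covC D (e m) x (e k x)) (e l x) = 0 := by
    have : Complex.I * (Cplx.pairing (g.inner x) (covC D (e k) x (e m x)) (e l x)
      + Cplx.pairing (g.inner x) (covC D (e m) x (e k x)) (e l x)) = 0 := by
      linear_combination 1 / 2 * hl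
    exact (mul_eq_zero.1 this).resolve_left Complex.I_ne_zero
  linear_combination 1 / 2 * h1 + 1 / 2 * h2 + hz
    + 1 / 2 * torsionAnti_antisymm (g := g) (nab := nab) (e := e) (x := x) m k l
    + 1 / 2 * torsionAnti_antisymm (g := g) (nab := nab) (e := e) (x := x) l m k
    + 1 / 2 * torsionAnti_antisymm (g := g) (nab := nab) (e := e) (x := x) l k m

/-- On a nearly Kähler manifold the components `τ_{kl}^m` vanish. -/
lemma torsionHol_eq_zero (S : FrameSetting g J D nab e U) (hx : x ∈ U) (hK : IsNearlyKahler J D)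
    (k l m : Fin n) : torsionHol g nab e x k l m = 0 := by
  have h := hK.covC_add S.herm S.isOpen (S.smooth k) (S.smooth m).conj hx
  have ht (a : Fin n) := fun y hy ↦ S.frame.type_one_zero y hy a
  rw [covC_extendLin S.herm S.isOpen (S.smooth k) (ht k) hx,
    covC_extendLin S.herm S.isOpen (S.smooth m).conj
      (fun y hy ↦ Cplx.extendLin_conj_of_eq (ht m y hy)) hx] at h
  have hl := congrArg (fun u ↦ Cplx.pairingₗ (g.inner x) u (e l x)) h
  simp only [map_sub, map_add, map_smul, LinearMap.sub_apply, LinearMap.add_apply, map_zero,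
    LinearMap.smul_apply, LinearMap.zero_apply, smul_eq_mul, ← Cplx.pairing_eq,
    Cplx.pairing_extendLin_left (S.herm.orthogonal x) _ (ht l x hx)] at hl
  have h1 := S.two_mul_pairing_levi hx k l (e m x).conj
  rw [S.torsionForm_conj_left hx, S.torsionForm_conj_right hx, sub_zero, sub_zero] at h1
  -- The eigenvalues are i on e_k and −i on conj e_m: the terms with D_{e_k} conj e_m cancel, those
  -- with the derivative of e_k along conj e_m add up.
  have hz : Complex.I * Cplx.pairing (g.inner x) (covC D (e k) x (e m x).conj) (e l x) = 0 := by
    linear_combination 1 / 2 * hl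
  rw [(mul_eq_zero.1 hz).resolve_left Complex.I_ne_zero, mul_zero] at h1
  exact h1.symm

variable [T2Space M]

/-- Since ∇ preserves type, the corrections involve only the components τ_{ab}^{c̄} themselves. Any
vanishing or linear symmetry of these components on `U` therefore passes to their covariant
derivatives. -/
lemma covTorsionAnti_eq_sum (S : FrameSetting g J D nab e U) (hx : x ∈ U) (k l i j : Fin n) :
    covTorsionAnti g nab e x k l i j =
      diffC (fun y ↦ torsionAnti g nab e y k l j) x (e i x)
        - ∑ m, holComp g e x (covC nab (e k) x (e i x)) m * torsionAnti g nab e x m l j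
        - ∑ m, holComp g e x (covC nab (e l) x (e i x)) m * torsionAnti g nab e x k m j
        - ∑ m, holComp g e x (covC nab (e j) x (e i x)) m * torsionAnti g nab e x k l m := by
  have h1 : torsionForm g nab x (e k x) (covC nab (e l) x (e i x)) (e j x) =
      ∑ m, holComp g e x (covC nab (e l) x (e i x)) m * torsionAnti g nab e x k m j := by
    rw [torsionForm_antisymm, S.torsionForm_eq_sum hx, ← Finset.sum_neg_distrib]
    refine Finset.sum_congr rfl fun m _ ↦ ?_
    rw [torsionForm_antisymm, mul_neg, neg_neg]
    rfl
  have h2 : torsionForm g nab x (e k x) (e l x) (covC nab (e j) x (e i x)) =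
      ∑ m, holComp g e x (covC nab (e j) x (e i x)) m * torsionAnti g nab e x k l m := by
    rw [torsionForm_apply, S.pairing_eq_sum hx]
    refine Finset.sum_congr rfl fun m _ ↦ ?_
    rw [S.pairing_nab hx, mul_zero, zero_add, mul_comm]
    rfl
  rw [S.covTorsionAnti_eq hx, S.torsionForm_eq_sum hx, h1, h2]
  rfl

lemma covTorsionAnti_eq_zero (S : FrameSetting g J D nab e U) (hx : x ∈ U) (hN : IsIntegrable J)
    (k l i j : Fin n) : covTorsionAnti g nab e x k l i j = 0 := by
  have h := diffC_congr (Filter.eventually_of_mem (S.isOpen.mem_nhds hx) fun y hy ↦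
    S.torsionAnti_eq_zero hy hN k l j) (e i x)
  rw [S.covTorsionAnti_eq_sum hx, h, diffC_zero]
  simp [S.torsionAnti_eq_zero hx hN]

lemma covTorsionAnti_swap (S : FrameSetting g J D nab e U) (hx : x ∈ U)
    (hK : IsNearlyKahler J D) (k l i j : Fin n) :
    covTorsionAnti g nab e x k l i j = -covTorsionAnti g nab e x j l i k := by
  have h := diffC_congr (Filter.eventually_of_mem (S.isOpen.mem_nhds hx) fun y hy ↦
    S.torsionAnti_swap hy hK k l j) (e i x)
  have hs (Γ : Fin n → ℂ) (a b c : Fin n → Fin n) :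
      ∑ m, Γ m * torsionAnti g nab e x (a m) (b m) (c m) =
        -∑ m, Γ m * torsionAnti g nab e x (c m) (b m) (a m) := by
    rw [← Finset.sum_neg_distrib]
    refine Finset.sum_congr rfl fun m _ ↦ ?_
    rw [S.torsionAnti_swap hx hK, mul_neg]
  rw [S.covTorsionAnti_eq_sum hx, S.covTorsionAnti_eq_sum hx, h, diffC_neg,
    hs _ (fun m ↦ m) (fun _ ↦ l) (fun _ ↦ j), hs _ (fun _ ↦ k) (fun m ↦ m) (fun _ ↦ j),
    hs _ (fun _ ↦ k) (fun _ ↦ l) (fun m ↦ m)]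
  ring

theorem curvComp_eq_zero_of_isIntegrable (S : FrameSetting g J D nab e U) (hx : x ∈ U)
    (hN : IsIntegrable J) (i j k l : Fin n) : curvComp g D e x i j k l = 0 := by
  rw [S.curvComp_eq_torsion hx]
  simp [S.torsionAnti_eq_zero hx hN, S.covTorsionAnti_eq_zero hx hN]

theorem curvComp_eq_zero_of_isNearlyKahler (S : FrameSetting g J D nab e U) (hx : x ∈ U)
    (hK : IsNearlyKahler J D) (i j k l : Fin n) : curvComp g D e x i j k l = 0 := by
  rw [S.curvComp_eq_torsion hx]
  simp only [S.torsionHol_eq_zero hx hK, zero_mul, mul_zero, add_zero, Finset.sum_const_zero,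
    sub_zero]
  have A := S.covTorsionAnti_antisymm hx
  have W := S.covTorsionAnti_swap hx hK
  have B (a b c d : Fin n) : covTorsionAnti g nab e x a b c d + covTorsionAnti g nab e x b c a d
      + covTorsionAnti g nab e x c a b d = 0 := by
    simpa [S.torsionHol_eq_zero hx hK] using S.bianchi hx a b c d
  generalize covTorsionAnti g nab e x = f at A W B ⊢
  -- `A` and `W` make f antisymmetric in its first, second and fourth arguments; this is the
  -- resulting cyclic invariance.
  have C (a b c d : Fin n) : f a b c d = f b d c a := by rw [W a b c d, A d b c a, neg_neg]
  -- By antisymmetry only one value of f remains for each differentiation index. The four signed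
  -- Bianchi sums then add up to three times the bracketed combination, whence 1/6 = (1/2)/3.
  linear_combination 1 / 6 * B k l i j - 1 / 6 * B k l j i - 1 / 6 * B i j l k + 1 / 6 * B i j k l
    - 1 / 6 * C l i k j - 1 / 6 * (A i k l j - C k i l j) + 1 / 6 * (A l j k i + C i j k l)
    - 1 / 6 * C i j l k + 1 / 6 * (A j l i k + C k l i j) - 1 / 6 * C k l j i
    - 1 / 6 * C j k i l - 1 / 6 * (A k i j l - C i k j l)
end FrameSetting

end SpecialCases

theorem mainTheorem8 {n : ℕ}
    {E : Type*} [NormedAddCommGroup E] [NormedSpace ℝ E] [FiniteDimensional ℝ E]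
    (hdim : Module.finrank ℝ E = 2 * n)
    {H : Type*} [TopologicalSpace H] {I : ModelWithCorners ℝ E H} [I.Boundaryless]
    {M : Type*} [TopologicalSpace M] [ChartedSpace H M] [IsManifold I ∞ M]
    [T2Space M] [SecondCountableTopology M]
    (g : ContMDiffRiemannianMetric I ∞ E (fun x : M ↦ TangentSpace I x))
    (J : Π x : M, TangentSpace I x →L[ℝ] TangentSpace I x) (hJ : IsAlmostHermitian g J)
    (D nab : CovariantDerivative I E (TangentSpace I : M → Type _))
    (hD : IsLeviCivita g D) (hnab : IsCanonicalConnection g J nab)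
    (U : Set M) (hU : IsOpen U)
    (e : Fin n → Π x : M, Cplx (TangentSpace I x)) (he : IsUnitaryFrameOn g J e U)
    (p : M) (hp : p ∈ U) :
    let RL := curvComp g D e p
    -- `t a b c` is `τ_{ab}^c`, `s a b c` is `τ_{ab}^{\bar c}`, `ds a b i c` is `τ_{ab;i}^{\bar c}`
    let t := torsionHol g nab e p
    let s := torsionAnti g nab e p
    let ds := covTorsionAnti g nab e p
    (∀ i j k l : Fin n,
      RL i j k l =
        1 / 2 * (ds k l i j - ds k l j i) + 1 / 2 * (ds i j k l - ds i j l k)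
        + 1 / 2 * ∑ m, (t i j m * s k l m + s i j m * t k l m)
        + 1 / 4 * ∑ m, t i k m * (s j l m - s l m j - s m j l)
        + 1 / 4 * ∑ m, t j l m * (s i k m - s k m i - s m i k)
        - 1 / 4 * ∑ m, t i l m * (s j k m - s k m j - s m j k)
        - 1 / 4 * ∑ m, t j k m * (s i l m - s l m i - s m i l)) ∧
    (IsIntegrable J → ∀ i j k l : Fin n, RL i j k l = 0) ∧
    (IsNearlyKahler J D → ∀ i j k l : Fin n, RL i j k l = 0) := by
  have S : FrameSetting g J D nab e U := ⟨hdim, hJ, hD, hnab, hU, he⟩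
  exact ⟨S.curvComp_eq_torsion hp, S.curvComp_eq_zero_of_isIntegrable hp,
    S.curvComp_eq_zero_of_isNearlyKahler hp⟩
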